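/- Fix parameters $R, R_D, \lambda, \alpha_C, \alpha_D, \rho_{BS}, \rho_D, \xi, \gamma, m > 0$. Let the base station (BS) be at the origin of $\mathbb{R}^2$ and let $\mathcal{A}$ be the disk of radius $R$ around it. Potential D2D users form a Poisson point process $\Phi=\{x_k\}$ on $\mathcal{A}$ with constant density $\lambda$; user $x_k$ has a receiver $y_k$ which is uniformly distributed in the disk of radius $R_D$ around $x_k$. A cellular user $z$ is uniformly distributed in $\mathcal{A}$. The user $x_k$ is in underlay D2D mode if $\rho_D |y_k-x_k|^{\alpha_D} |x_k|^{-\alpha_C}<\xi$. The signal-to-interference ratio at the receiver $y_j$ is $$\mathrm{SIR}_j=\frac{g_{0,j}\,\rho_D}{I_j},\qquad I_j=\frac{g_{z,j}\,\rho_{BS}|z|^{\alpha_C}}{|z-y_j|^{\alpha_D}}+\sum_{k\ne j}\frac{g_{k,j}\,\rho_D|y_k-x_k|^{\alpha_D}}{|x_k-y_j|^{\alpha_D}}\,\mathbf{1}\bigl(\rho_D |y_k-x_k|^{\alpha_D} |x_k|^{-\alpha_C}<\xi\bigr),$$ where the power gains $g_{z,j}, g_{k,j}$ of the interfering links are exponential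 with mean $1$ (Rayleigh fading) and the power gains $g_{0,j}$ of the reference links are Gamma distributed with shape $m$ and mean $1$ (Nakagami-$m$ fading). The process $\Phi$, the displacements $y_k-x_k$, the location $z$ and all the gains are independent. Let $\lambda^{DRx}(d)$ be the node density of the receivers $\{y_k\}$ at distance $d$ from the BS (the density of their intensity measure with respect to area); let $p_{D2D}(d)$ be the conditional probability that a potential D2D user (uniform in $\mathcal{A}$, with receiver as above) is in underlay D2D mode given that its receiver is at distance $d$ from the BS; and let $P_{out}^{DRx}(\gamma,d)$ be the probability that $\mathrm{SIR}<\gamma$ at a typical receiver located at a point at distance $d$ from the BS, with its own independent fading gains, where the interference comes from $z$ and from all the users of $\Phi$ in underlay D2D mode. Then $\lambda^{DRx}$ is well defined (the intensity measure of the receivers has a density with respect to area, which depends only on the distance from the BS); $P_{out}^{DRx}(\gamma,d)$ does not depend on the choice of the point at distance $d$, and it is (a version of) the conditional probability of the event $\mathrm{SIR}_j<\gamma$ given that an underlay receiver $y_j$ lies at distance $d$ from the BS, i.e. the intensity measure of the underlay receivers with $\mathrm{SIR}_j<\gamma$ has density $P_{out}^{DRx}(\gamma,|\cdot|)$ with respect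 to the intensity measure of all underlay receivers. Moreover, the number of users in underlay D2D mode with $\mathrm{SIR}_j>\gamma$ (the successful underlay D2D transmissions) is integrable, and its mean $\bar M$ is $$\bar M=\int_0^{R+R_D}\bigl(1-P_{out}^{DRx}(\gamma,d)\bigr)\,p_{D2D}(d)\,\lambda^{DRx}(d)\,2\pi d\,\mathrm{d}d,$$ where the integrand is integrable. -/

import Mathlib

open MeasureTheory ProbabilityTheory
open scoped ENNReal NNReal

/-- The Euclidean plane; the base station is at the origin. -/
abbrev Plane : Type := EuclideanSpace ℝ (Fin 2)

noncomputable section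

namespace D2D

/-! ### Point processes -/

/-- `Φ` is a Poisson point process with intensity measure `μ` under the law `P`: a random measure
whose value on each measurable set of finite intensity is Poisson distributed, with independent
values on disjoint sets. -/
structure IsPoissonPP {Ω E : Type*} [MeasurableSpace Ω] [MeasurableSpace E]
    (Φ : Ω → Measure E) (μ : Measure E) (P : Measure Ω) : Prop where
  measurable : Measurable Φ
  law : ∀ B : Set E, MeasurableSet B → μ B ≠ ∞ →
    P.map (fun ω => Φ ω B) = (poissonMeasure (μ B).toNNReal).map (fun n : ℕ => (n : ℝ≥0∞))
  indep : ∀ (n : ℕ) (B : Fin n → Set E), (∀ i, MeasurableSet (B i)) →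
    (Pairwise fun i j => Disjoint (B i) (B j)) → iIndepFun (fun i ω => Φ ω (B i)) P

/-- The intensity (mean) measure `B ↦ E[Ψ(B)]` of a point process `Ψ`. -/
def intensity {Ω E : Type*} [MeasurableSpace Ω] [MeasurableSpace E]
    (P : Measure Ω) (Ψ : Ω → Measure E) : Measure E :=
  P.bind Ψ

/-! ### The system -/

/-- The deterministic parameters of the system. -/
structure Params where
  /-- radius of the cell -/
  R : ℝ
  /-- maximal D2D range -/
  RD : ℝ
  /-- density of the potential D2D users -/
  lam : ℝ
  /-- path-loss exponent on cellular links -/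
  αC : ℝ
  /-- path-loss exponent on D2D links -/
  αD : ℝ
  /-- sensitivity of the base station -/
  ρBS : ℝ
  /-- sensitivity of a D2D receiver -/
  ρD : ℝ
  /-- mode selection threshold -/
  ξ : ℝ
  /-- SIR threshold -/
  γ : ℝ
  /-- Nakagami parameter of the reference D2D links -/
  m : ℝ
  R_pos : 0 < R
  RD_pos : 0 < RD
  lam_pos : 0 < lam
  αC_pos : 0 < αC
  αD_pos : 0 < αD
  ρBS_pos : 0 < ρBS
  ρD_pos : 0 < ρD
  ξ_pos : 0 < ξ
  γ_pos : 0 < γ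
  m_pos : 0 < m

namespace Params

variable (p : Params)

/-- The cell `𝒜`: the disk of radius `R` around the base station. -/
def cell : Set Plane := Metric.closedBall 0 p.R

/-- A potential D2D user at `x` with receiver at `y` is in underlay mode: its average interference
`ρD * ‖y - x‖ ^ αD * ‖x‖ ^ (-αC)` at the base station is below `ξ` (infinite for `x = 0`). -/
def Underlay (x y : Plane) : Prop := p.ρD * ‖y - x‖ ^ p.αD < p.ξ * ‖x‖ ^ p.αC

/-- Interference at `v`, with fading gain `g`, from the cellular user at `z`, who transmits with
power `ρBS * ‖z‖ ^ αC`. -/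
def cueInterference (g : ℝ) (z v : Plane) : ℝ :=
  g * (p.ρBS * ‖z‖ ^ p.αC) / ‖z - v‖ ^ p.αD

open Classical in
/-- Interference at `v`, with fading gain `g`, from the potential D2D user at `x` with receiver at
`y`, who transmits with power `ρD * ‖y - x‖ ^ αD` if in underlay mode and is absent otherwise. -/
def d2dInterference (g : ℝ) (x y v : Plane) : ℝ :=
  if p.Underlay x y then g * (p.ρD * ‖y - x‖ ^ p.αD) / ‖x - v‖ ^ p.αD else 0

/-- The law of the location of an independently and uniformly distributed potential D2D user,
together with the displacement from it to its receiver. -/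
def pairLaw : Measure (Plane × Plane) :=
  (volume[|p.cell]).prod (volume[|Metric.closedBall (0 : Plane) p.RD])

instance : IsFiniteMeasure p.pairLaw := by
  unfold pairLaw; infer_instance

/-- `p_D2D(d)`: the conditional probability that a potential D2D user is in underlay D2D mode given
that the distance of its receiver to the base station is `d`. -/
def pD2D (d : ℝ) : ℝ :=
  (condDistrib (fun q : Plane × Plane => q) (fun q => ‖q.1 + q.2‖)
    p.pairLaw d).real
    {q | p.Underlay q.1 (q.1 + q.2)}

end Params

instance isProbabilityMeasure_expMeasure_one : IsProbabilityMeasure (expMeasure 1) :=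
  isProbabilityMeasure_expMeasure one_pos

/-- The random quantities of the system, with `N` the number of potential D2D users. -/
structure Network (Ω : Type*) where
  /-- number of potential D2D users -/
  N : Ω → ℕ
  /-- location of the `k`-th potential D2D user, for `k < N` -/
  x : ℕ → Ω → Plane
  /-- displacement from the `k`-th potential D2D user to its receiver -/
  u : ℕ → Ω → Plane
  /-- location of the cellular user -/
  z : Ω → Plane
  /-- fading gain from the cellular user to the `j`-th receiver -/
  gz : ℕ → Ω → ℝ
  /-- fading gain from the `k`-th potential D2D user to the `j`-th receiver (`g k j`, `k ≠ j`) -/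
  g : ℕ → ℕ → Ω → ℝ
  /-- fading gain on the reference link from the `j`-th potential D2D user to its own receiver -/
  g0 : ℕ → Ω → ℝ

/-- Labels of the independent sources of randomness. -/
inductive Source : Type
  | users : Source
  | displacement (k : ℕ) : Source
  | cue : Source
  | cueGain (j : ℕ) : Source
  | gain (k j : ℕ) : Source
  | refGain (j : ℕ) : Source

namespace Network

variable {Ω : Type*} (S : Network Ω)

/-- Location of the `k`-th D2D receiver. -/
def y (k : ℕ) (ω : Ω) : Plane := S.x k ω + S.u k ω

/-- `Φ`, the point process of potential D2D users. -/
def userPoints (ω : Ω) : Measure Plane :=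
  ∑ k ∈ Finset.range (S.N ω), Measure.dirac (S.x k ω)

/-- `Φ^DRx`, the point process of D2D receivers. -/
def receiverPoints (ω : Ω) : Measure Plane :=
  ∑ k ∈ Finset.range (S.N ω), Measure.dirac (S.y k ω)

/-- The sub-σ-algebra generated by a source of randomness. -/
@[reducible]
def sourceAlgebra (S : Network Ω) : Source → MeasurableSpace Ω
  | .users => MeasurableSpace.comap (fun ω => (S.N ω, fun k => S.x k ω)) inferInstance
  | .displacement k => MeasurableSpace.comap (S.u k) inferInstance
  | .cue => MeasurableSpace.comap S.z inferInstance
  | .cueGain j => MeasurableSpace.comap (S.gz j) inferInstance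
  | .gain k j => MeasurableSpace.comap (S.g k j) inferInstance
  | .refGain j => MeasurableSpace.comap (S.g0 j) inferInstance

/-- The system model: the potential D2D users form a Poisson process of constant density `lam` on
the cell, the receivers are uniform in the disks of radius `RD` around their users, the cellular
user is uniform in the cell, the interfering links are Rayleigh fading (exponential power gains of
mean one), the reference links are Nakagami-`m` fading (gamma power gains of mean one), and all of
these are independent. -/
structure IsModel [MeasurableSpace Ω] (S : Network Ω) (p : Params) (P : Measure Ω) : Prop where
  measurable_N : Measurable S.N
  measurable_x : ∀ k, Measurable (S.x k)
  measurable_u : ∀ k, Measurable (S.u k)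
  measurable_z : Measurable S.z
  measurable_gz : ∀ j, Measurable (S.gz j)
  measurable_g : ∀ k j, Measurable (S.g k j)
  measurable_g0 : ∀ j, Measurable (S.g0 j)
  poisson : IsPoissonPP S.userPoints
    (ENNReal.ofReal p.lam • (volume : Measure Plane).restrict p.cell) P
  law_u : ∀ k, pdf.IsUniform (S.u k) (Metric.closedBall (0 : Plane) p.RD) P
  law_z : pdf.IsUniform S.z p.cell P
  law_gz : ∀ j, HasLaw (S.gz j) (expMeasure 1) P
  law_g : ∀ k j, HasLaw (S.g k j) (expMeasure 1) P
  law_g0 : ∀ j, HasLaw (S.g0 j) (gammaMeasure p.m p.m) P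
  indep : iIndep S.sourceAlgebra P

variable (p : Params)

/-- Aggregate interference at the `j`-th receiver. -/
def interference (j : ℕ) (ω : Ω) : ℝ :=
  p.cueInterference (S.gz j ω) (S.z ω) (S.y j ω) +
    ∑ k ∈ (Finset.range (S.N ω)).erase j,
      p.d2dInterference (S.g k j ω) (S.x k ω) (S.y k ω) (S.y j ω)

/-- Signal-to-interference ratio at the `j`-th receiver. -/
def SIR (j : ℕ) (ω : Ω) : ℝ := S.g0 j ω * p.ρD / S.interference p j ω

open Classical in
/-- The indices of the users in underlay D2D mode. -/
def underlayIndices (ω : Ω) : Finset ℕ :=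
  (Finset.range (S.N ω)).filter fun k => p.Underlay (S.x k ω) (S.y k ω)

/-- `Φ_u^DRx`, the point process of underlay D2D receivers. -/
def underlayReceiverPoints (ω : Ω) : Measure Plane :=
  ∑ k ∈ S.underlayIndices p ω, Measure.dirac (S.y k ω)

open Classical in
/-- The point process of underlay D2D receivers that are in outage. -/
def outageReceiverPoints (ω : Ω) : Measure Plane :=
  ∑ k ∈ (S.underlayIndices p ω).filter fun k => S.SIR p k ω < p.γ, Measure.dirac (S.y k ω)

open Classical in
/-- The number of successful underlay D2D transmissions. -/
def successCount (ω : Ω) : ℕ :=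
  ((S.underlayIndices p ω).filter fun j => p.γ < S.SIR p j ω).card

/-- Aggregate interference, from the cellular user and all underlay D2D users of the network, at a
typical receiver located at `v`, whose interfering links have gains `hz` and `h k`. -/
def typicalInterference (v : Plane) (ω : Ω) (hz : ℝ) (h : ℕ → ℝ) : ℝ :=
  p.cueInterference hz (S.z ω) v +
    ∑ k ∈ Finset.range (S.N ω), p.d2dInterference (h k) (S.x k ω) (S.y k ω) v

/-- The outage probability at a typical D2D receiver located at `v`, averaged over its own fading
gains (reference gain `h0`, interfering gains `hz`, `h k`) and over the network. -/
def outageAt [MeasurableSpace Ω] (P : Measure Ω) (v : Plane) : ℝ :=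
  (P.prod ((gammaMeasure p.m p.m).prod
    ((expMeasure 1).prod (Measure.infinitePi fun _ : ℕ => expMeasure 1)))).real
    {w | w.2.1 * p.ρD / S.typicalInterference p v w.1 w.2.2.1 w.2.2.2 < p.γ}

/-- `P_out^DRx(γ, d)`: the outage probability at a typical D2D receiver at distance `d` from the
base station. -/
def outage [MeasurableSpace Ω] (P : Measure Ω) (d : ℝ) : ℝ := S.outageAt p P !₂[d, 0]

/-- `λ^DRx(d)`: the mean number of D2D receivers per unit area at distance `d` from the base
station, i.e. the density of the distances of the receivers with respect to the area element. -/
def lamDRx [MeasurableSpace Ω] (P : Measure Ω) (d : ℝ) : ℝ :=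
  (((intensity P S.receiverPoints).map fun v => ‖v‖).rnDeriv
    ((volume : Measure Plane).map fun v => ‖v‖) d).toReal

end Network

end D2D

end

/-! The mean number of successful transmissions is a sum over the users, and the claim is Campbell's
formula for it, with the distance of the receiver from the base station as the variable of
integration.

The points of the Poisson process `Φ` come with a labelling about which nothing is assumed. So the
law of the process is needed in the form of `IsPoissonPP.setLIntegral_eq_of_symmetric`: on the event
`N = n`, symmetric functionals of the labelled points have the expectation that they have for the
measure `e^{-μ(E)} μ^n / n!`. By uniqueness of product measures it suffices to test the symmetrized
law on boxes, and then to count the points in the finitely many cells cut out by the sides of a box.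
Their numbers are independent Poisson variables.

Displacements and gains are independent marks of the users. Splitting off one coordinate of the
product measure gives the Campbell–Mecke formula `Network.IsModel.lintegral_sum_range_eq`: a sum
over the users of a weight times the indicator of an SIR event is the integral of the weight times
the probability `Params.typicalProb` of the event at a typical receiver. It yields the intensity
measures of all receivers, of the underlay receivers, and of those in outage, and it yields the mean
number of successes. The typical probability of `SIR > γ` is one minus the outage probability,
because the gamma law of the reference gain has no atoms and the event `SIR = γ` is therefore null.

All laws are invariant under linear isometries of the plane, which act transitively on the points at
a given distance from the origin. Hence the typical probabilities and the density of the receivers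
are radial, and the latter is `lamDRx`. Conditioning on the distance of the receiver replaces the
mode selection by `pD2D`, and integration in polar coordinates turns the integral over the plane
into the one over `[0, R + RD]`, outside of which there are no receivers. -/

noncomputable section

namespace D2D

/-! ### The law of a Poisson process with labelled points -/

section

open scoped Nat

/-- The permutations `σ` with `a ∘ σ = f` form a coset of the stabilizer of `f`, unless there are
none. -/
lemma card_perm_comp_eq {n : ℕ} {K : Type*} [Fintype K] [DecidableEq K] (a f : Fin n → K) :
    (Finset.univ.filter fun σ : Equiv.Perm (Fin n) => a ∘ σ = f).card =
      if ∀ k, Fintype.card {i // a i = k} = Fintype.card {i // f i = k} then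
        ∏ k, (Fintype.card {i // f i = k})! else 0 := by
  split_ifs with h
  · have e : ∀ k, {i // f i = k} ≃ {i // a i = k} := fun k => Fintype.equivOfCardEq (h k).symm
    let τ : Equiv.Perm (Fin n) :=
      (Equiv.sigmaFiberEquiv f).symm.trans ((Equiv.sigmaCongrRight e).trans
        (Equiv.sigmaFiberEquiv a))
    have hτ : a ∘ τ = f := by
      funext i
      exact (e (f i) ⟨i, rfl⟩).2
    rw [← DomMulAct.stabilizer_card f, ← Fintype.card_subtype]
    refine Fintype.card_congr ((Equiv.mulLeft τ⁻¹).subtypeEquiv fun σ => ?_)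
    rw [Equiv.coe_mulLeft, ← hτ]
    have : (a ∘ τ) ∘ ⇑(τ⁻¹ * σ) = a ∘ σ := by
      funext i; simp
    rw [this, hτ]
  · rw [Finset.card_eq_zero, Finset.filter_eq_empty_iff]
    intro σ _ hσ
    refine h fun k => Fintype.card_congr ?_
    refine (σ.subtypeEquiv fun i => ?_).symm
    rw [← hσ]; rfl

namespace IsPoissonPP

section

variable {Ω E : Type*} [MeasurableSpace Ω] [MeasurableSpace E] {P : Measure Ω}
  {μ : Measure E} [IsFiniteMeasure μ]

lemma measure_eq_natCast {Φ : Ω → Measure E} (hΦ : IsPoissonPP Φ μ P) {B : Set E}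
    (hB : MeasurableSet B) (m : ℕ) :
    P {ω | Φ ω B = m} = ENNReal.ofReal (Real.exp (-(μ B).toReal)) * μ B ^ m / (m)! := by
  have hmeas : Measurable fun ω => Φ ω B := (Measure.measurable_coe hB).comp hΦ.measurable
  have h1 : P {ω | Φ ω B = m} = P.map (fun ω => Φ ω B) {(m : ℝ≥0∞)} := by
    rw [Measure.map_apply hmeas (measurableSet_singleton _)]; rfl
  rw [h1, hΦ.law B hB (measure_ne_top _ _),
    Measure.map_apply .of_discrete (measurableSet_singleton _)]
  have h2 : (fun n : ℕ => (n : ℝ≥0∞)) ⁻¹' {(m : ℝ≥0∞)} = {m} := by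
    ext n; simp
  rw [h2, poissonMeasure_singleton, ENNReal.ofReal_div_of_pos (by positivity),
    ENNReal.ofReal_mul (by positivity), ENNReal.ofReal_natCast,
    ENNReal.ofReal_pow (by positivity), ENNReal.ofReal_coe_nnreal,
    ENNReal.coe_toNNReal (measure_ne_top _ _)]
  rfl

lemma measure_forall_eq_natCast {Φ : Ω → Measure E} (hΦ : IsPoissonPP Φ μ P)
    {K : Type*} [Fintype K] [MeasurableSpace K] [MeasurableSingletonClass K]
    {c : E → K} (hc : Measurable c) (m : K → ℕ) :
    P {ω | ∀ k, Φ ω (c ⁻¹' {k}) = m k} =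
      ∏ k, (ENNReal.ofReal (Real.exp (-(μ (c ⁻¹' {k})).toReal)) *
        μ (c ⁻¹' {k}) ^ m k / (m k)!) := by
  have hm : ∀ k, MeasurableSet (c ⁻¹' {k}) := fun k => hc (measurableSet_singleton k)
  let e := Fintype.equivFin K
  have hi := hΦ.indep (Fintype.card K) (fun i => c ⁻¹' {e.symm i}) (fun i => hm _)
    (fun i j hij => by
      refine Disjoint.preimage _ ?_
      simpa using fun h => hij h)
  have := hi.measure_inter_preimage_eq_mul Finset.univ
    (sets := fun i => {(m (e.symm i) : ℝ≥0∞)}) (fun i _ => measurableSet_singleton _)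
  have hset : {ω | ∀ k, Φ ω (c ⁻¹' {k}) = m k} =
      ⋂ i ∈ Finset.univ, (fun ω => Φ ω (c ⁻¹' {e.symm i})) ⁻¹' {(m (e.symm i) : ℝ≥0∞)} := by
    ext ω
    simp [e.forall_congr_left]
  rw [hset, this, ← e.symm.prod_comp]
  exact Finset.prod_congr rfl fun i _ => measure_eq_natCast hΦ (hm _) _

variable {N : Ω → ℕ} {x : ℕ → Ω → E}

omit [IsFiniteMeasure μ] in
lemma measurableSet_pattern (hN : Measurable N) (hx : ∀ k, Measurable (x k))
    {K : Type*} [MeasurableSpace K] [MeasurableSingletonClass K]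
    {c : E → K} (hc : Measurable c) (n : ℕ) (s : Fin n → ℕ) (f : Fin n → K) :
    MeasurableSet {ω | N ω = n ∧ ∀ i, c (x (s i) ω) = f i} := by
  have h : {ω | N ω = n ∧ ∀ i, c (x (s i) ω) = f i} =
      N ⁻¹' {n} ∩ ⋂ i, (fun ω => c (x (s i) ω)) ⁻¹' {f i} := by
    ext ω; simp
  rw [h]
  exact (hN (measurableSet_singleton n)).inter
    (MeasurableSet.iInter fun i => (hc.comp (hx _)) (measurableSet_singleton _))

/-- For a classification `c` of the points into finitely many types, the expected number of ways to
relabel the points so that their types are `f 0, …, f (n - 1)`. If the number of points of each type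
is the one prescribed by `f`, there are as many ways as the product of the factorials of these
numbers, which cancels the factorials in the Poisson weights. -/
lemma sum_perm_measure_eq (hN : Measurable N) (hx : ∀ k, Measurable (x k))
    (hΦ : IsPoissonPP (fun ω => ∑ k ∈ Finset.range (N ω), Measure.dirac (x k ω)) μ P)
    {K : Type*} [Fintype K] [DecidableEq K] [MeasurableSpace K] [MeasurableSingletonClass K]
    {c : E → K} (hc : Measurable c) {n : ℕ} (f : Fin n → K) :
    ∑ σ : Equiv.Perm (Fin n), P {ω | N ω = n ∧ ∀ i, c (x (σ i) ω) = f i} =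
      ENNReal.ofReal (Real.exp (-(μ Set.univ).toReal)) * ∏ i, μ (c ⁻¹' {f i}) := by
  have hm : ∀ k, MeasurableSet (c ⁻¹' {k}) := fun k => hc (measurableSet_singleton k)
  set m : K → ℕ := fun k => Fintype.card {i // f i = k} with hmdef
  -- the event that each type occurs as often as `f` prescribes
  set T : Set Ω :=
    {ω | ∀ k, (∑ j ∈ Finset.range (N ω), Measure.dirac (x j ω)) (c ⁻¹' {k}) = m k} with hT
  have hTm : MeasurableSet T := by
    rw [hT, Set.ofPred_forall]
    refine MeasurableSet.iInter fun k => ?_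
    exact ((Measure.measurable_coe (hm k)).comp hΦ.measurable) (measurableSet_singleton _)
  have hcount : ∀ ω k, (∑ j ∈ Finset.range (N ω), Measure.dirac (x j ω)) (c ⁻¹' {k}) =
      (Fintype.card {i : Fin (N ω) // c (x i ω) = k} : ℝ≥0∞) := by
    intro ω k
    rw [Measure.finsetSum_apply, Fintype.card_subtype, Finset.card_filter, Finset.sum_range]
    push_cast
    refine Finset.sum_congr rfl fun i _ => ?_
    rw [Measure.dirac_apply' _ (hm k)]
    by_cases h : c (x i ω) = k
    · rw [Set.indicator_of_mem (by exact h), if_pos h]; rfl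
    · rw [Set.indicator_of_notMem (by exact h), if_neg h]
  have hSm : ∀ σ : Equiv.Perm (Fin n),
      MeasurableSet {ω | N ω = n ∧ ∀ i, c (x (σ i) ω) = f i} := by
    intro σ
    exact measurableSet_pattern hN hx hc n _ f
  have hpt : ∀ ω, ∑ σ : Equiv.Perm (Fin n),
      {ω | N ω = n ∧ ∀ i, c (x (σ i) ω) = f i}.indicator (1 : Ω → ℝ≥0∞) ω =
        T.indicator (fun _ => ∏ k, ((m k)! : ℝ≥0∞)) ω := by
    intro ω
    by_cases h : N ω = n
    · have h1 := card_perm_comp_eq (fun i : Fin n => c (x i ω)) f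
      have h2 : ω ∈ T ↔ ∀ k, Fintype.card {i : Fin n // c (x i ω) = k} =
          Fintype.card {i // f i = k} := by
        subst h
        simp only [hT, Set.mem_ofPred_eq, hcount, hmdef, Nat.cast_inj]
      have h3 : ∀ σ : Equiv.Perm (Fin n),
          {ω | N ω = n ∧ ∀ i, c (x (σ i) ω) = f i}.indicator (1 : Ω → ℝ≥0∞) ω =
            if (fun i : Fin n => c (x i ω)) ∘ σ = f then 1 else 0 := by
        intro σ
        simp [Set.indicator_apply, h, funext_iff]
      simp_rw [h3]
      rw [Finset.sum_boole, h1, Set.indicator_apply]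
      simp only [h2]
      split_ifs <;> simp [hmdef]
    · have h2 : ω ∉ T := by
        intro hω
        apply h
        have h4 : ∀ k, Fintype.card {i : Fin (N ω) // c (x i ω) = k} = m k := by
          intro k
          have := hω k
          rw [hcount] at this
          exact_mod_cast this
        have h5 := Fintype.card_congr (Equiv.sigmaFiberEquiv fun i : Fin (N ω) => c (x i ω))
        have h6 := Fintype.card_congr (Equiv.sigmaFiberEquiv f)
        rw [Fintype.card_sigma, Fintype.card_fin] at h5 h6
        rw [← h5, ← h6]
        exact Finset.sum_congr rfl fun k _ => h4 k
      rw [Set.indicator_of_notMem h2]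
      refine Finset.sum_eq_zero fun σ _ => ?_
      simp [h]
  calc ∑ σ : Equiv.Perm (Fin n), P {ω | N ω = n ∧ ∀ i, c (x (σ i) ω) = f i}
      = ∑ σ : Equiv.Perm (Fin n), ∫⁻ ω, {ω | N ω = n ∧ ∀ i, c (x (σ i) ω) = f i}.indicator
          (1 : Ω → ℝ≥0∞) ω ∂P :=
        Finset.sum_congr rfl fun σ _ => (lintegral_indicator_one (hSm σ)).symm
    _ = ∫⁻ ω, T.indicator (fun _ => ∏ k, ((m k)! : ℝ≥0∞)) ω ∂P := by
        rw [← lintegral_finsetSum _ fun σ _ => measurable_one.indicator (hSm σ)]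
        exact lintegral_congr hpt
    _ = ∏ k, (ENNReal.ofReal (Real.exp (-(μ (c ⁻¹' {k})).toReal)) * μ (c ⁻¹' {k}) ^ m k) := by
        rw [lintegral_indicator_const hTm, hT, measure_forall_eq_natCast hΦ hc,
          ← Finset.prod_mul_distrib]
        refine Finset.prod_congr rfl fun k _ => ?_
        rw [ENNReal.mul_div_cancel (by exact_mod_cast Nat.factorial_ne_zero _)
          (ENNReal.natCast_ne_top _)]
    _ = _ := by
        rw [Finset.prod_mul_distrib]
        congr 1
        · rw [← ENNReal.ofReal_prod_of_nonneg fun _ _ => (Real.exp_pos _).le, ← Real.exp_sum,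
            Finset.sum_neg_distrib]
          congr 3
          rw [← ENNReal.toReal_sum fun _ _ => measure_ne_top _ _]
          congr 1
          rw [← tsum_fintype (L := .unconditional _), ← measure_iUnion _ hm]
          · congr 1
            ext y; simp
          · intro k l hkl
            exact Disjoint.preimage _ (by simpa using hkl)
        · rw [← Finset.prod_fiberwise_of_maps_to (s := Finset.univ) (t := Finset.univ) (g := f)
            fun _ _ => Finset.mem_univ _]
          refine Finset.prod_congr rfl fun k _ => ?_
          rw [Finset.prod_congr rfl (g := fun _ => μ (c ⁻¹' {k}))]
          · simp [hmdef, Fintype.card_subtype]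
          · intro i hi
            rw [(Finset.mem_filter.1 hi).2]

/-- The labelling of the points is arbitrary and may depend on their positions, but after
symmetrization over all labellings the law of `n` points is that of a Poisson process. -/
lemma sum_perm_map_eq_pi (hN : Measurable N) (hx : ∀ k, Measurable (x k))
    (hΦ : IsPoissonPP (fun ω => ∑ k ∈ Finset.range (N ω), Measure.dirac (x k ω)) μ P) (n : ℕ) :
    ∑ σ : Equiv.Perm (Fin n), (P.restrict {ω | N ω = n}).map (fun ω (i : Fin n) => x (σ i) ω) =
      ENNReal.ofReal (Real.exp (-(μ Set.univ).toReal)) • Measure.pi fun _ : Fin n => μ := by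
  classical
  set a := ENNReal.ofReal (Real.exp (-(μ Set.univ).toReal)) with ha
  have ha0 : a ≠ 0 := by simp [ha, Real.exp_pos]
  have hat : a ≠ ∞ := ENNReal.ofReal_ne_top
  have hxm : ∀ σ : Equiv.Perm (Fin n), Measurable fun ω (i : Fin n) => x (σ i) ω := fun σ =>
    measurable_pi_lambda _ fun i => hx _
  have key : Measure.pi (fun _ : Fin n => μ) =
      a⁻¹ • ∑ σ : Equiv.Perm (Fin n),
        (P.restrict {ω | N ω = n}).map (fun ω (i : Fin n) => x (σ i) ω) := by
    refine Measure.pi_eq fun s hs => ?_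
    -- classify a point by the set of those sides of the box that contain it
    let c : E → (Fin n → Prop) := fun y i => y ∈ s i
    have hc : Measurable c := measurable_pi_lambda _ fun i => measurable_mem.2 (hs i)
    let F : Finset (Fin n → Fin n → Prop) := Finset.univ.filter fun f => ∀ i, f i i
    have hdis : Pairwise (Function.onFun Disjoint fun k : Fin n → Prop => c ⁻¹' {k}) :=
      fun k l hkl => Disjoint.preimage _ (by simpa using hkl)
    have hL : ∀ σ : Equiv.Perm (Fin n),
        (P.restrict {ω | N ω = n}).map (fun ω (i : Fin n) => x (σ i) ω) (Set.univ.pi s) =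
          ∑ f ∈ F, P {ω | N ω = n ∧ ∀ i, c (x (σ i) ω) = f i} := by
      intro σ
      have hms : ∀ f : Fin n → Fin n → Prop,
          MeasurableSet {ω | N ω = n ∧ ∀ i, c (x (σ i) ω) = f i} := by
        intro f
        exact measurableSet_pattern hN hx hc n _ f
      rw [Measure.map_apply (hxm σ) (MeasurableSet.univ_pi hs),
        Measure.restrict_apply (hxm σ (MeasurableSet.univ_pi hs)),
        ← measure_biUnion_finset _ fun f _ => hms f]
      · congr 1
        ext ω
        simp only [Set.mem_inter_iff, Set.mem_preimage, Set.mem_univ_pi, Set.mem_ofPred_eq,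
          Set.mem_iUnion, F, Finset.mem_filter, Finset.mem_univ, true_and, exists_prop]
        constructor
        · rintro ⟨h1, h2⟩
          exact ⟨fun i => c (x (σ i) ω), h1, h2, fun i => rfl⟩
        · rintro ⟨f, hf, h1, h2⟩
          refine ⟨fun i => ?_, h1⟩
          have := hf i
          rwa [← h2 i] at this
      · intro f _ g _ hfg
        refine Set.disjoint_left.2 fun ω hf hg => hfg ?_
        funext i
        rw [← hf.2 i, ← hg.2 i]
    have hR : ∀ i, μ (s i) = ∑ k ∈ Finset.univ.filter (fun k : Fin n → Prop => k i),
        μ (c ⁻¹' {k}) := by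
      intro i
      rw [← measure_biUnion_finset (fun k _ l _ hkl => hdis hkl)
        fun k _ => hc (measurableSet_singleton k)]
      congr 1
      ext y
      simp [c]
    rw [Measure.smul_apply, Measure.finsetSum_apply, Finset.sum_congr rfl fun σ _ => hL σ,
      Finset.sum_comm, Finset.sum_congr rfl fun f _ => sum_perm_measure_eq hN hx hΦ hc f,
      ← Finset.mul_sum, smul_eq_mul, ← mul_assoc, ENNReal.inv_mul_cancel ha0 hat, one_mul,
      Finset.prod_congr rfl fun i _ => hR i, Finset.prod_univ_sum]
    refine Finset.sum_congr ?_ fun _ _ => rfl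
    ext f
    simp [F]
  rw [key, smul_smul, ENNReal.mul_inv_cancel ha0 hat, one_smul]

/-- The weight `e^{-μ(E)} / n!` of `n` points in a Poisson process of intensity `μ`, relative to the
`n`-fold product of `μ`. -/
def weight (μ : Measure E) (n : ℕ) : ℝ≥0∞ :=
  ENNReal.ofReal (Real.exp (-(μ Set.univ).toReal)) / (n)!

/-- The law of a Poisson process with finite intensity: on the event of `n` points, a symmetric
functional has the same expectation as at `n` independent points, however the points are
labelled. -/
lemma setLIntegral_eq_of_symmetric (hN : Measurable N) (hx : ∀ k, Measurable (x k))
    (hΦ : IsPoissonPP (fun ω => ∑ k ∈ Finset.range (N ω), Measure.dirac (x k ω)) μ P) {n : ℕ}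
    {H : (Fin n → E) → ℝ≥0∞} (hH : Measurable H)
    (hsymm : ∀ (σ : Equiv.Perm (Fin n)) q, H (fun i => q (σ i)) = H q) :
    ∫⁻ ω in {ω | N ω = n}, H (fun i => x i ω) ∂P =
      weight μ n * ∫⁻ q, H q ∂(Measure.pi fun _ : Fin n => μ) := by
  have h := congrArg (fun ρ : Measure (Fin n → E) => ∫⁻ q, H q ∂ρ) (sum_perm_map_eq_pi hN hx hΦ n)
  simp only [lintegral_finsetSum_measure, lintegral_smul_measure] at h
  have h2 : ∀ σ : Equiv.Perm (Fin n),
      ∫⁻ q, H q ∂((P.restrict {ω | N ω = n}).map (fun ω (i : Fin n) => x (σ i) ω)) =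
        ∫⁻ ω in {ω | N ω = n}, H (fun i => x i ω) ∂P := by
    intro σ
    rw [lintegral_map hH (measurable_pi_lambda _ fun i => hx _)]
    exact lintegral_congr fun ω => hsymm σ (fun i => x i ω)
  rw [Finset.sum_congr rfl fun σ _ => h2 σ, Finset.sum_const, Finset.card_univ, Fintype.card_perm,
    Fintype.card_fin, nsmul_eq_mul, smul_eq_mul] at h
  rw [weight, ← ENNReal.mul_div_right_comm,
    ENNReal.eq_div_iff (by exact_mod_cast Nat.factorial_ne_zero _) (ENNReal.natCast_ne_top _)]
  exact h

end

end IsPoissonPP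

end

/-! ### Measurability and independence in the network -/

lemma measurable_sum_range {α M : Type*} [MeasurableSpace α] [MeasurableSpace M]
    [AddCommMonoid M] [MeasurableAdd₂ M] {n : α → ℕ} (hn : Measurable n) {f : ℕ → α → M}
    (hf : ∀ k, Measurable (f k)) :
    Measurable fun a => ∑ k ∈ Finset.range (n a), f k a := by
  have h : Measurable fun q : ℕ × α => ∑ k ∈ Finset.range q.1, f k q.2 :=
    measurable_from_prod_countable_right fun m =>
      Finset.measurable_sum (Finset.range m) fun k _ => hf k
  exact h.comp (hn.prodMk measurable_id)

lemma measurable_sum_range_erase {α M : Type*} [MeasurableSpace α] [MeasurableSpace M]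
    [AddCommMonoid M] [MeasurableAdd₂ M] {n : α → ℕ} (hn : Measurable n) {f : ℕ → α → M}
    (hf : ∀ k, Measurable (f k)) (j : ℕ) :
    Measurable fun a => ∑ k ∈ (Finset.range (n a)).erase j, f k a := by
  have h : Measurable fun q : ℕ × α => ∑ k ∈ (Finset.range q.1).erase j, f k q.2 :=
    measurable_from_prod_countable_right fun m =>
      Finset.measurable_sum ((Finset.range m).erase j) fun k _ => hf k
  exact h.comp (hn.prodMk measurable_id)

namespace Params

variable (p : Params)

lemma measurableSet_underlay : MeasurableSet {q : Plane × Plane | p.Underlay q.1 q.2} := by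
  unfold Underlay
  apply measurableSet_lt <;> fun_prop

lemma measurable_d2dInterference :
    Measurable fun q : ℝ × Plane × Plane × Plane =>
      p.d2dInterference q.1 q.2.1 q.2.2.1 q.2.2.2 := by
  unfold d2dInterference
  refine Measurable.ite ?_ (by fun_prop) measurable_const
  exact (measurable_fst.comp measurable_snd |>.prodMk
    (measurable_fst.comp (measurable_snd.comp measurable_snd))) p.measurableSet_underlay

lemma measurable_cueInterference :
    Measurable fun q : ℝ × Plane × Plane => p.cueInterference q.1 q.2.1 q.2.2 := by
  unfold cueInterference
  fun_prop

/-- The intensity measure of the potential D2D users. -/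
def userIntensity : Measure Plane := ENNReal.ofReal p.lam • (volume : Measure Plane).restrict p.cell

/-- The law of the displacement from a user to its receiver. -/
def displacementLaw : Measure Plane := volume[|Metric.closedBall (0 : Plane) p.RD]

/-- The law of the location of the cellular user. -/
def cueLaw : Measure Plane := volume[|p.cell]

lemma volume_closedBall_ne_zero {r : ℝ} (hr : 0 < r) (v : Plane) :
    (volume : Measure Plane) (Metric.closedBall v r) ≠ 0 :=
  (Metric.measure_closedBall_pos volume v hr).ne'

lemma volume_closedBall_ne_top (r : ℝ) (v : Plane) :
    (volume : Measure Plane) (Metric.closedBall v r) ≠ ∞ :=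
  measure_closedBall_lt_top.ne

instance : IsFiniteMeasure p.userIntensity := by
  have : IsFiniteMeasure ((volume : Measure Plane).restrict p.cell) :=
    ⟨by rw [Measure.restrict_apply_univ]; exact measure_closedBall_lt_top⟩
  unfold userIntensity
  exact Measure.smul_finite _ ENNReal.ofReal_ne_top

instance : IsProbabilityMeasure p.displacementLaw :=
  cond_isProbabilityMeasure_of_finite (volume_closedBall_ne_zero p.RD_pos 0)
    (volume_closedBall_ne_top _ _)

instance : IsProbabilityMeasure p.cueLaw :=
  cond_isProbabilityMeasure_of_finite (volume_closedBall_ne_zero p.R_pos 0)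
    (volume_closedBall_ne_top _ _)

/-- The law of the fading gain on a reference link: gamma of shape `m` and mean one. -/
def refGainLaw : Measure ℝ := gammaMeasure p.m p.m

instance : IsProbabilityMeasure p.refGainLaw :=
  isProbabilityMeasure_gammaMeasure p.m_pos p.m_pos

end Params

namespace Network

variable {Ω : Type*} (S : Network Ω)

/-- The number of potential D2D users, together with their locations. -/
def users (ω : Ω) : ℕ × (ℕ → Plane) := (S.N ω, fun k => S.x k ω)

/-- The part of the network that a typical receiver sees: the users, the displacements to their
receivers and the cellular user, but no gains. -/
def geometry (ω : Ω) : (ℕ × (ℕ → Plane)) × (ℕ → Plane) × Plane :=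
  (S.users ω, fun k => S.u k ω, S.z ω)

/-- The gains at the `j`-th receiver: the reference gain, the gain from the cellular user, and the
gains from the potential D2D users. -/
def gains (j : ℕ) (ω : Ω) : ℝ × ℝ × (ℕ → ℝ) :=
  (S.g0 j ω, S.gz j ω, fun k => S.g k j ω)

namespace IsModel

variable {S} [MeasurableSpace Ω] {P : Measure Ω} [IsProbabilityMeasure P] {p : Params}

section

variable (hS : S.IsModel p P)
include hS

omit [IsProbabilityMeasure P] in
lemma measurable_users : Measurable S.users :=
  hS.measurable_N.prodMk (measurable_pi_lambda _ hS.measurable_x)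

omit [IsProbabilityMeasure P] in
lemma measurable_geometry : Measurable S.geometry :=
  hS.measurable_users.prodMk
    ((measurable_pi_lambda _ hS.measurable_u).prodMk hS.measurable_z)

omit [IsProbabilityMeasure P] in
lemma measurable_gains (j : ℕ) : Measurable (S.gains j) :=
  (hS.measurable_g0 j).prodMk
    ((hS.measurable_gz j).prodMk (measurable_pi_lambda _ fun k => hS.measurable_g k j))

omit [IsProbabilityMeasure P] in
lemma sourceAlgebra_le (s : Source) : S.sourceAlgebra s ≤ (inferInstance : MeasurableSpace Ω) := by
  cases s with
  | users => exact hS.measurable_users.comap_le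
  | displacement k => exact (hS.measurable_u k).comap_le
  | cue => exact hS.measurable_z.comap_le
  | cueGain j => exact (hS.measurable_gz j).comap_le
  | gain k j => exact (hS.measurable_g k j).comap_le
  | refGain j => exact (hS.measurable_g0 j).comap_le

/-- Random variables that depend on disjoint sets of sources are independent. -/
lemma map_prodMk_eq_prod {I : Set Source} {α β : Type*} [MeasurableSpace α] [MeasurableSpace β]
    {f : Ω → α} {g : Ω → β} (hf : Measurable[⨆ s ∈ I, S.sourceAlgebra s] f)
    (hg : Measurable[⨆ s ∈ Iᶜ, S.sourceAlgebra s] g) :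
    P.map (fun ω => (f ω, g ω)) = (P.map f).prod (P.map g) := by
  have hi : IndepFun f g P := by
    rw [IndepFun_iff_Indep]
    exact indep_of_indep_of_le_left (indep_of_indep_of_le_right
      (indep_iSup_of_disjoint hS.sourceAlgebra_le hS.indep disjoint_compl_right)
      hg.comap_le) hf.comap_le
  have hle : ∀ I : Set Source, (⨆ s ∈ I, S.sourceAlgebra s) ≤ (inferInstance : MeasurableSpace Ω) :=
    fun I => iSup₂_le fun s _ => hS.sourceAlgebra_le s
  exact (indepFun_iff_map_prod_eq_prod_map_map (hf.mono (hle I) le_rfl).aemeasurable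
    (hg.mono (hle Iᶜ) le_rfl).aemeasurable).1 hi

end

section

variable {I : Set Source}

omit [MeasurableSpace Ω] in
lemma measurable_of_source (s : Source) (hs : s ∈ I) {α : Type*} [MeasurableSpace α] {f : Ω → α}
    (hf : Measurable[S.sourceAlgebra s] f) : Measurable[⨆ s ∈ I, S.sourceAlgebra s] f :=
  hf.mono (le_iSup₂ (f := fun s (_ : s ∈ I) => S.sourceAlgebra s) s hs) le_rfl

omit [MeasurableSpace Ω] in
lemma measurable_family {ι : Type*} (s : ι → Source) (hs : ∀ i, s i ∈ I) {α : Type*}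
    [MeasurableSpace α] {f : ι → Ω → α} (hf : ∀ i, Measurable[S.sourceAlgebra (s i)] (f i)) :
    Measurable[⨆ s ∈ I, S.sourceAlgebra s] fun ω i => f i ω :=
  @measurable_pi_lambda _ _ _ (⨆ s ∈ I, S.sourceAlgebra s) _ _ fun i =>
    measurable_of_source (s i) (hs i) (hf i)

end

section

variable (hS : S.IsModel p P)
include hS

omit [IsProbabilityMeasure P] in
lemma map_z : P.map S.z = p.cueLaw := hS.law_z

omit [IsProbabilityMeasure P] in
lemma map_u (k : ℕ) : P.map (S.u k) = p.displacementLaw := hS.law_u k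

omit [IsProbabilityMeasure P] in
lemma map_g0 (j : ℕ) : P.map (S.g0 j) = p.refGainLaw := (hS.law_g0 j).map_eq

omit [IsProbabilityMeasure P] in
lemma map_u_fin (n : ℕ) :
    P.map (fun ω (i : Fin n) => S.u i ω) = Measure.pi fun _ => p.displacementLaw := by
  have h : iIndepFun (fun i : Fin n => S.u i) P :=
    hS.indep.precomp (g := fun i : Fin n => Source.displacement i) fun a b h => by
      simpa [Fin.ext_iff] using h
  rw [h.map_fun_eq_pi_map fun i : Fin n => (hS.measurable_u i).aemeasurable]
  simp_rw [hS.map_u]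

omit [IsProbabilityMeasure P] in
lemma map_g_fin (n j : ℕ) :
    P.map (fun ω (i : Fin n) => S.g i j ω) = Measure.pi fun _ => expMeasure 1 := by
  have h : iIndepFun (fun i : Fin n => S.g i j) P :=
    hS.indep.precomp (g := fun i : Fin n => Source.gain i j) fun a b h => by
      simpa [Fin.ext_iff] using h
  rw [h.map_fun_eq_pi_map fun i : Fin n => (hS.measurable_g i j).aemeasurable]
  simp_rw [(hS.law_g _ j).map_eq]

omit [IsProbabilityMeasure P] in
lemma map_g_seq (j : ℕ) :
    P.map (fun ω (i : ℕ) => S.g i j ω) = Measure.infinitePi fun _ => expMeasure 1 := by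
  have h : iIndepFun (fun i : ℕ => S.g i j) P :=
    hS.indep.precomp (g := fun i : ℕ => Source.gain i j) fun a b h => by
      simpa using h
  rw [h.map_fun_eq_infinitePi_map fun i => hS.measurable_g i j]
  congr 1
  funext i
  exact (hS.law_g i j).map_eq

/-- The gains at any of the receivers are fresh gains for a typical receiver, so the law defining
`outageAt` can be realized on `Ω` itself. -/
lemma map_geometry_gains (j : ℕ) :
    P.map (fun ω => (S.geometry ω, S.gains j ω)) =
      (P.map S.geometry).prod (p.refGainLaw.prod
        ((expMeasure 1).prod (Measure.infinitePi fun _ : ℕ => expMeasure 1))) := by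
  have m1 : P.map (fun ω => (S.gz j ω, fun k => S.g k j ω)) =
      (expMeasure 1).prod (Measure.infinitePi fun _ : ℕ => expMeasure 1) := by
    rw [hS.map_prodMk_eq_prod (I := {Source.cueGain j}) (f := S.gz j), (hS.law_gz j).map_eq,
      hS.map_g_seq]
    · exact measurable_of_source (.cueGain j) (by simp) (comap_measurable _)
    · exact measurable_family (fun k => .gain k j) (by simp) fun k => comap_measurable _
  have m2 : P.map (S.gains j) = p.refGainLaw.prod
      ((expMeasure 1).prod (Measure.infinitePi fun _ : ℕ => expMeasure 1)) := by
    unfold gains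
    rw [hS.map_prodMk_eq_prod (I := {Source.refGain j}) (f := S.g0 j), hS.map_g0, m1]
    · exact measurable_of_source (.refGain j) (by simp) (comap_measurable _)
    · exact (measurable_of_source (.cueGain j) (by simp) (comap_measurable _)).prodMk
        (measurable_family (fun k => .gain k j) (by simp) fun k => comap_measurable _)
  rw [hS.map_prodMk_eq_prod (I := {Source.users, Source.cue} ∪ Set.range Source.displacement),
    m2]
  · exact (measurable_of_source .users (by simp) (comap_measurable _)).prodMk
      ((measurable_family (fun k => .displacement k) (by simp) fun k => comap_measurable _).prodMk
        (measurable_of_source .cue (by simp) (comap_measurable _)))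
  · exact (measurable_of_source (.refGain j) (by simp) (comap_measurable _)).prodMk
      ((measurable_of_source (.cueGain j) (by simp) (comap_measurable _)).prodMk
        (measurable_family (fun k => .gain k j) (by simp) fun k => comap_measurable _))

lemma map_users_marks (n j : ℕ) :
    P.map (fun ω => (S.users ω, ((fun i : Fin n => S.u i ω), fun i : Fin n => S.g i j ω),
        S.z ω, S.g0 j ω, S.gz j ω)) =
      (P.map S.users).prod (((Measure.pi fun _ : Fin n => p.displacementLaw).prod
        (Measure.pi fun _ : Fin n => expMeasure 1)).prod
          (p.cueLaw.prod (p.refGainLaw.prod (expMeasure 1)))) := by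
  have m1 : P.map (fun ω => (S.g0 j ω, S.gz j ω)) = p.refGainLaw.prod (expMeasure 1) := by
    rw [hS.map_prodMk_eq_prod (I := {Source.refGain j}), (hS.law_gz j).map_eq, hS.map_g0]
    · exact measurable_of_source (.refGain j) (by simp) (comap_measurable _)
    · exact measurable_of_source (.cueGain j) (by simp) (comap_measurable _)
  have m2 : P.map (fun ω => (S.z ω, S.g0 j ω, S.gz j ω)) =
      p.cueLaw.prod (p.refGainLaw.prod (expMeasure 1)) := by
    rw [hS.map_prodMk_eq_prod (I := {Source.cue}) (f := S.z), hS.map_z, m1]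
    · exact measurable_of_source .cue (by simp) (comap_measurable _)
    · exact (measurable_of_source (.refGain j) (by simp) (comap_measurable _)).prodMk
        (measurable_of_source (.cueGain j) (by simp) (comap_measurable _))
  have m3 : P.map (fun ω => ((fun i : Fin n => S.u i ω), fun i : Fin n => S.g i j ω)) =
      (Measure.pi fun _ : Fin n => p.displacementLaw).prod
        (Measure.pi fun _ : Fin n => expMeasure 1) := by
    rw [hS.map_prodMk_eq_prod (I := Set.range Source.displacement), hS.map_u_fin, hS.map_g_fin]
    · exact measurable_family (fun k : Fin n => .displacement k) (by simp)
        fun k => comap_measurable _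
    · exact measurable_family (fun k : Fin n => .gain k j) (by simp) fun k => comap_measurable _
  have m4 : P.map (fun ω => (((fun i : Fin n => S.u i ω), fun i : Fin n => S.g i j ω),
        S.z ω, S.g0 j ω, S.gz j ω)) =
      ((Measure.pi fun _ : Fin n => p.displacementLaw).prod
        (Measure.pi fun _ : Fin n => expMeasure 1)).prod
          (p.cueLaw.prod (p.refGainLaw.prod (expMeasure 1))) := by
    rw [hS.map_prodMk_eq_prod
      (I := Set.range Source.displacement ∪ Set.range fun k => Source.gain k j), m2, m3]
    · exact (measurable_family (fun k : Fin n => .displacement k) (by simp)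
        fun k => comap_measurable _).prodMk
        (measurable_family (fun k : Fin n => .gain k j) (by simp) fun k => comap_measurable _)
    · exact (measurable_of_source .cue (by simp) (comap_measurable _)).prodMk
        ((measurable_of_source (.refGain j) (by simp) (comap_measurable _)).prodMk
        (measurable_of_source (.cueGain j) (by simp) (comap_measurable _)))
  rw [hS.map_prodMk_eq_prod (I := {Source.users}) (f := S.users), m4]
  · exact measurable_of_source .users (by simp) (comap_measurable _)
  · exact ((measurable_family (fun k : Fin n => .displacement k) (by simp)
        fun k => comap_measurable _).prodMk
        (measurable_family (fun k : Fin n => .gain k j) (by simp)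
          fun k => comap_measurable _)).prodMk
      ((measurable_of_source .cue (by simp) (comap_measurable _)).prodMk
        ((measurable_of_source (.refGain j) (by simp) (comap_measurable _)).prodMk
        (measurable_of_source (.cueGain j) (by simp) (comap_measurable _))))

end

end IsModel
end Network

/-! ### Marked users -/

lemma lintegral_eq_tsum_setLIntegral {Ω : Type*} [MeasurableSpace Ω] (P : Measure Ω) {N : Ω → ℕ}
    (hN : Measurable N) (f : Ω → ℝ≥0∞) :
    ∫⁻ ω, f ω ∂P = ∑' n, ∫⁻ ω in {ω | N ω = n}, f ω ∂P := by
  rw [← lintegral_iUnion (fun n => show MeasurableSet {ω | N ω = n} from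
    hN (measurableSet_singleton n))]
  · have : ⋃ n, {ω | N ω = n} = Set.univ := by ext ω; simp
    rw [this, setLIntegral_univ]
  · intro i j hij
    exact Set.disjoint_left.2 fun ω hi hj => hij (hi.symm.trans hj)

lemma sum_range_erase_eq {M : Type*} [AddCommGroup M] {n : ℕ} (f : ℕ → M) (j : Fin n) :
    ∑ k ∈ (Finset.range n).erase j, f k = ∑ k ∈ Finset.univ.erase j, f k := by
  have h1 := Finset.add_sum_erase (Finset.range n) f (Finset.mem_range.2 j.2)
  have h2 := Finset.add_sum_erase Finset.univ (fun k : Fin n => f k) (Finset.mem_univ j)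
  rw [Finset.sum_range] at h1
  exact add_left_cancel (h1.trans h2.symm)

lemma sum_erase_eq_sum_succAbove {M : Type*} [AddCommGroup M] {n : ℕ} (f : Fin (n + 1) → M)
    (j : Fin (n + 1)) :
    ∑ k ∈ Finset.univ.erase j, f k = ∑ i, f (j.succAbove i) := by
  have h := Finset.add_sum_erase Finset.univ f (Finset.mem_univ j)
  rw [Fin.sum_univ_succAbove f j] at h
  exact add_left_cancel h

lemma sum_erase_perm {M : Type*} [AddCommMonoid M] {n : ℕ} (f : Fin n → M) (j : Fin n)
    (σ : Equiv.Perm (Fin n)) :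
    ∑ k ∈ Finset.univ.erase j, f (σ k) = ∑ k ∈ Finset.univ.erase (σ j), f k := by
  refine Finset.sum_equiv σ (fun k => ?_) fun _ _ => rfl
  simp

lemma measurePreserving_perm {α : Type*} [MeasurableSpace α] (κ : Measure α) [SigmaFinite κ]
    {n : ℕ} (σ : Equiv.Perm (Fin n)) :
    MeasurePreserving (fun (m : Fin n → α) i => m (σ i)) (Measure.pi fun _ => κ)
      (Measure.pi fun _ => κ) := by
  have h := measurePreserving_piCongrLeft (fun _ : Fin n => κ) σ.symm
  have e : ⇑(MeasurableEquiv.piCongrLeft (fun _ : Fin n => α) σ.symm) =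
      fun (m : Fin n → α) i => m (σ i) := by
    funext m i
    have := Equiv.piCongrLeft_apply_apply (fun _ : Fin n => α) σ.symm m (σ i)
    rw [Equiv.symm_apply_apply] at this
    exact this
  rwa [e] at h

/-- A potential D2D user as seen from a given receiver: its location, the displacement to its own
receiver, and the fading gain from it to the given receiver. -/
abbrev MarkedUser : Type := Plane × Plane × ℝ

namespace Params

variable (p : Params)

/-- The law of the displacement and the gain that are attached to a potential D2D user. -/
def markLaw : Measure (Plane × ℝ) := p.displacementLaw.prod (expMeasure 1)

instance : IsProbabilityMeasure p.markLaw := by unfold markLaw; infer_instance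

/-- The intensity measure of the Poisson process of marked users. -/
def markedIntensity : Measure MarkedUser := p.userIntensity.prod p.markLaw

instance : IsFiniteMeasure p.markedIntensity := by unfold markedIntensity; infer_instance

/-- The law of the location of the cellular user, the reference gain, and the gain from the cellular
user. -/
def cueRefLaw : Measure (Plane × ℝ × ℝ) := p.cueLaw.prod (p.refGainLaw.prod (expMeasure 1))

instance : IsProbabilityMeasure p.cueRefLaw := by unfold cueRefLaw; infer_instance

/-- The SIR at `v` if the D2D users interfere with total power `t`, and `c` consists of the location
of the cellular user, the reference gain, and the gain from the cellular user. -/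
def sirOf (v : Plane) (t : ℝ) (c : Plane × ℝ × ℝ) : ℝ :=
  c.2.1 * p.ρD / (p.cueInterference c.2.2 c.1 v + t)

/-- The interference at `v` from a marked user. -/
def userInterference (v : Plane) (q : MarkedUser) : ℝ :=
  p.d2dInterference q.2.2 q.1 (q.1 + q.2.1) v

lemma measurable_sirOf :
    Measurable fun a : Plane × ℝ × (Plane × ℝ × ℝ) => p.sirOf a.1 a.2.1 a.2.2 := by
  unfold sirOf
  have h : Measurable fun a : Plane × ℝ × (Plane × ℝ × ℝ) => (a.2.2.2.2, a.2.2.1, a.1) := by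
    fun_prop
  have h' := p.measurable_cueInterference.comp h
  simp only [Function.comp_def] at h'
  fun_prop

lemma measurable_userInterference :
    Measurable fun a : Plane × MarkedUser => p.userInterference a.1 a.2 := by
  have h1 : Measurable fun a : Plane × MarkedUser => a.2.1 + a.2.2.1 :=
    (measurable_fst.comp measurable_snd).add
      (measurable_fst.comp (measurable_snd.comp measurable_snd))
  have h : Measurable fun a : Plane × MarkedUser => (a.2.2.2, a.2.1, a.2.1 + a.2.2.1, a.1) :=
    (measurable_snd.comp (measurable_snd.comp measurable_snd)).prodMk
      ((measurable_fst.comp measurable_snd).prodMk (h1.prodMk measurable_fst))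
  unfold userInterference
  simpa only [Function.comp_def] using p.measurable_d2dInterference.comp h

/-- The conditional probability that the SIR at `v` lies in `A` given that the D2D users interfere
with total power `t`. -/
def sirProb (A : Set ℝ) (v : Plane) (t : ℝ) : ℝ≥0∞ :=
  p.cueRefLaw {c | p.sirOf v t c ∈ A}

lemma lintegral_indicator_sirOf {A : Set ℝ} (hA : MeasurableSet A) (v : Plane) (t : ℝ) :
    ∫⁻ c, A.indicator 1 (p.sirOf v t c) ∂p.cueRefLaw = p.sirProb A v t := by
  have hm : Measurable (p.sirOf v t) :=
    p.measurable_sirOf.comp (show Measurable fun c : Plane × ℝ × ℝ => (v, t, c) by fun_prop)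
  rw [sirProb, ← lintegral_indicator_one (show MeasurableSet {c | p.sirOf v t c ∈ A} from hm hA)]
  rfl

lemma measurable_sirProb {A : Set ℝ} (hA : MeasurableSet A) :
    Measurable fun a : Plane × ℝ => p.sirProb A a.1 a.2 := by
  refine measurable_measure_prodMk_left (ν := p.cueRefLaw)
    (s := {b : (Plane × ℝ) × (Plane × ℝ × ℝ) | p.sirOf b.1.1 b.1.2 b.2 ∈ A}) ?_
  exact (p.measurable_sirOf.comp (show Measurable fun b : (Plane × ℝ) × (Plane × ℝ × ℝ) =>
      (b.1.1, b.1.2, b.2) by fun_prop)) hA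

/-- The probability that the SIR at a typical receiver at `v` lies in `A`, as the expectation over a
Poisson process of marked users. -/
def typicalProb (A : Set ℝ) (v : Plane) : ℝ≥0∞ :=
  ∑' n, IsPoissonPP.weight p.userIntensity n *
    ∫⁻ q : Fin n → MarkedUser, p.sirProb A v (∑ i, p.userInterference v (q i))
      ∂Measure.pi fun _ => p.markedIntensity

lemma measurable_sum_userInterference (n : ℕ) :
    Measurable fun a : Plane × (Fin n → MarkedUser) => ∑ i, p.userInterference a.1 (a.2 i) :=
  Finset.measurable_sum _ fun i _ => by
    have h : Measurable fun a : Plane × (Fin n → MarkedUser) => (a.1, a.2 i) :=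
      measurable_fst.prodMk ((measurable_pi_apply i).comp measurable_snd)
    simpa only [Function.comp_def] using p.measurable_userInterference.comp h

lemma measurable_sirProb_sum {A : Set ℝ} (hA : MeasurableSet A) (n : ℕ) :
    Measurable fun a : Plane × (Fin n → MarkedUser) =>
      p.sirProb A a.1 (∑ i, p.userInterference a.1 (a.2 i)) := by
  simpa only [Function.comp_def] using
    (p.measurable_sirProb hA).comp (measurable_fst.prodMk (p.measurable_sum_userInterference n))

lemma measurable_typicalProb {A : Set ℝ} (hA : MeasurableSet A) :
    Measurable (p.typicalProb A) := by
  unfold typicalProb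
  refine Measurable.tsum fun n => Measurable.const_mul ?_ _
  exact (p.measurable_sirProb_sum hA n).lintegral_prod_right'

end Params

namespace Network

variable {Ω : Type*} (S : Network Ω)

/-- The `k`-th potential D2D user as seen from the `j`-th receiver. -/
def markedUser (j k : ℕ) (ω : Ω) : MarkedUser := (S.x k ω, S.u k ω, S.g k j ω)

/-- The cellular user, the reference gain, and the gain from the cellular user, at the `j`-th
receiver. -/
def cueRef (j : ℕ) (ω : Ω) : Plane × ℝ × ℝ := (S.z ω, S.g0 j ω, S.gz j ω)

namespace IsModel

variable {S} [MeasurableSpace Ω] {P : Measure Ω} [IsProbabilityMeasure P] {p : Params}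
  (hS : S.IsModel p P)
include hS

omit [IsProbabilityMeasure P] in
lemma measurable_markedUser (j k : ℕ) : Measurable (S.markedUser j k) :=
  (hS.measurable_x k).prodMk ((hS.measurable_u k).prodMk (hS.measurable_g k j))

omit [IsProbabilityMeasure P] in
lemma measurable_cueRef (j : ℕ) : Measurable (S.cueRef j) :=
  hS.measurable_z.prodMk ((hS.measurable_g0 j).prodMk (hS.measurable_gz j))

/-- The marks of the users are independent of the users, so they can be integrated out first. -/
lemma setLIntegral_marks (n j : ℕ) {G : (Fin n → MarkedUser) × (Plane × ℝ × ℝ) → ℝ≥0∞}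
    (hG : Measurable G) :
    ∫⁻ ω in {ω | S.N ω = n}, G (fun i => S.markedUser j i ω, S.cueRef j ω) ∂P =
      ∫⁻ ω in {ω | S.N ω = n}, ∫⁻ m, ∫⁻ c, G (fun i => (S.x i ω, m i), c) ∂p.cueRefLaw
        ∂(Measure.pi fun _ : Fin n => p.markLaw) ∂P := by
  have hNm : MeasurableSet {ω | S.N ω = n} := hS.measurable_N (measurableSet_singleton n)
  let F : (ℕ × (ℕ → Plane)) × (((Fin n → Plane) × (Fin n → ℝ)) × (Plane × ℝ × ℝ)) → ℝ≥0∞ :=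
    fun a => {b : ℕ × (ℕ → Plane) | b.1 = n}.indicator
      (fun b => G (fun i => (b.2 i, a.2.1.1 i, a.2.1.2 i), a.2.2)) a.1
  have hset : MeasurableSet {a : (ℕ × (ℕ → Plane)) ×
      (((Fin n → Plane) × (Fin n → ℝ)) × (Plane × ℝ × ℝ)) | a.1.1 = n} :=
    (measurable_fst.comp measurable_fst) (measurableSet_singleton n)
  have hF : Measurable F := by
    have h0 : Measurable fun a : (ℕ × (ℕ → Plane)) ×
        (((Fin n → Plane) × (Fin n → ℝ)) × (Plane × ℝ × ℝ)) =>
        G (fun i => (a.1.2 i, a.2.1.1 i, a.2.1.2 i), a.2.2) := by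
      refine hG.comp (Measurable.prodMk (measurable_pi_lambda _ fun i => ?_) (by fun_prop))
      fun_prop
    exact h0.indicator hset
  have hmp : MeasurePreserving (MeasurableEquiv.arrowProdEquivProdArrow Plane ℝ (Fin n))
      (Measure.pi fun _ => p.markLaw) ((Measure.pi fun _ => p.displacementLaw).prod
        (Measure.pi fun _ => expMeasure 1)) :=
    measurePreserving_arrowProdEquivProdArrow Plane ℝ (Fin n)
      (fun _ => p.displacementLaw) (fun _ => expMeasure 1)
  calc ∫⁻ ω in {ω | S.N ω = n}, G (fun i => S.markedUser j i ω, S.cueRef j ω) ∂P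
      = ∫⁻ ω, F (S.users ω, ((fun i : Fin n => S.u i ω), fun i : Fin n => S.g i j ω),
        S.z ω, S.g0 j ω, S.gz j ω) ∂P := by
        rw [← lintegral_indicator hNm]; rfl
    _ = ∫⁻ a, F a ∂((P.map S.users).prod (((Measure.pi fun _ : Fin n => p.displacementLaw).prod
        (Measure.pi fun _ : Fin n => expMeasure 1)).prod p.cueRefLaw)) := by
        rw [Params.cueRefLaw, ← hS.map_users_marks n j, lintegral_map hF]
        exact hS.measurable_users.prodMk
          (((measurable_pi_lambda _ fun i : Fin n => hS.measurable_u i).prodMk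
            (measurable_pi_lambda _ fun i : Fin n => hS.measurable_g i j)).prodMk
              (hS.measurable_cueRef j))
    _ = ∫⁻ ω, ∫⁻ m, ∫⁻ c, F (S.users ω, m, c) ∂p.cueRefLaw
          ∂((Measure.pi fun _ : Fin n => p.displacementLaw).prod
            (Measure.pi fun _ : Fin n => expMeasure 1)) ∂P := by
        have := Measure.isProbabilityMeasure_map (μ := P) hS.measurable_users.aemeasurable
        rw [lintegral_prod _ hF.aemeasurable,
          lintegral_map hF.lintegral_prod_right' hS.measurable_users]
        refine lintegral_congr fun ω => ?_
        rw [lintegral_prod]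
        exact (hF.comp measurable_prodMk_left).aemeasurable
    _ = _ := by
        rw [← lintegral_indicator hNm]
        refine lintegral_congr fun ω => ?_
        rw [← hmp.lintegral_comp_emb (MeasurableEquiv.measurableEmbedding _)]
        by_cases h : S.N ω = n
        · rw [Set.indicator_of_mem (show ω ∈ {ω | S.N ω = n} from h)]
          refine lintegral_congr fun m => lintegral_congr fun c => ?_
          exact Set.indicator_of_mem (show S.users ω ∈ {b : ℕ × (ℕ → Plane) | b.1 = n} from h) _
        · rw [Set.indicator_of_notMem (show ω ∉ {ω | S.N ω = n} from h)]
          refine (lintegral_congr fun m => lintegral_congr fun c =>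
            Set.indicator_of_notMem
              (show S.users ω ∉ {b : ℕ × (ℕ → Plane) | b.1 = n} from h) _).trans ?_
          simp

/-- The law of the marked users on the event of `n` users, for a functional that is symmetric only
after summation over `a`. Each summand may involve the gains at a receiver `l a` of its own. -/
lemma sum_setLIntegral_eq {n : ℕ} {ι : Type*} [Fintype ι] (l : ι → ℕ)
    {G : ι → (Fin n → MarkedUser) × (Plane × ℝ × ℝ) → ℝ≥0∞} (hG : ∀ a, Measurable (G a))
    (hsymm : ∀ (σ : Equiv.Perm (Fin n)) (q : Fin n → MarkedUser),
      ∑ a, ∫⁻ c, G a (fun i => q (σ i), c) ∂p.cueRefLaw = ∑ a, ∫⁻ c, G a (q, c) ∂p.cueRefLaw) :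
    ∑ a, ∫⁻ ω in {ω | S.N ω = n}, G a (fun i => S.markedUser (l a) i ω, S.cueRef (l a) ω) ∂P =
      IsPoissonPP.weight p.userIntensity n *
        ∑ a, ∫⁻ q, ∫⁻ c, G a (q, c) ∂p.cueRefLaw ∂Measure.pi fun _ => p.markedIntensity := by
  have hGc : ∀ a, Measurable fun q => ∫⁻ c, G a (q, c) ∂p.cueRefLaw :=
    fun a => (hG a).lintegral_prod_right'
  have hzip : Measurable fun b : (Fin n → Plane) × (Fin n → Plane × ℝ) =>
      fun i => (b.1 i, b.2 i) := by
    refine measurable_pi_lambda _ fun i => ?_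
    fun_prop
  have hmp : MeasurePreserving (MeasurableEquiv.arrowProdEquivProdArrow Plane (Plane × ℝ) (Fin n))
      (Measure.pi fun _ => p.markedIntensity) ((Measure.pi fun _ => p.userIntensity).prod
        (Measure.pi fun _ => p.markLaw)) :=
    measurePreserving_arrowProdEquivProdArrow Plane (Plane × ℝ) (Fin n)
      (fun _ => p.userIntensity) (fun _ => p.markLaw)
  let T : (Fin n → MarkedUser) → ℝ≥0∞ := fun q => ∑ a, ∫⁻ c, G a (q, c) ∂p.cueRefLaw
  have hT : Measurable T := Finset.measurable_sum _ fun a _ => hGc a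
  have hTz : Measurable fun b : (Fin n → Plane) × (Fin n → Plane × ℝ) =>
      T fun i => (b.1 i, b.2 i) := hT.comp hzip
  let H : (Fin n → Plane) → ℝ≥0∞ := fun x =>
    ∫⁻ m, T (fun i => (x i, m i)) ∂(Measure.pi fun _ : Fin n => p.markLaw)
  have hH : Measurable H := hTz.lintegral_prod_right'
  -- the law of the marks is invariant under relabelling, so integrating them out keeps the symmetry
  have hHs : ∀ (σ : Equiv.Perm (Fin n)) x, H (fun i => x (σ i)) = H x := by
    intro σ x
    have hm : Measurable fun m : Fin n → Plane × ℝ => T fun i => (x (σ i), m i) :=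
      hTz.comp (g := fun b : (Fin n → Plane) × (Fin n → Plane × ℝ) => T fun i => (b.1 i, b.2 i))
        (measurable_prodMk_left (x := fun i => x (σ i)))
    calc H (fun i => x (σ i)) = ∫⁻ m, T (fun i => (x (σ i), m (σ i)))
          ∂(Measure.pi fun _ : Fin n => p.markLaw) :=
        ((measurePreserving_perm p.markLaw σ).lintegral_comp hm).symm
      _ = H x := lintegral_congr fun m => hsymm σ fun i => (x i, m i)
  calc ∑ a, ∫⁻ ω in {ω | S.N ω = n}, G a (fun i => S.markedUser (l a) i ω, S.cueRef (l a) ω) ∂P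
      = ∑ a, ∫⁻ ω in {ω | S.N ω = n}, ∫⁻ m, ∫⁻ c, G a (fun i => (S.x i ω, m i), c) ∂p.cueRefLaw
        ∂(Measure.pi fun _ : Fin n => p.markLaw) ∂P :=
        Finset.sum_congr rfl fun a _ => hS.setLIntegral_marks n (l a) (hG a)
    _ = ∫⁻ ω in {ω | S.N ω = n}, H (fun i => S.x i ω) ∂P := by
        have hx : Measurable fun ω (i : Fin n) => S.x i ω :=
          measurable_pi_lambda _ fun i => hS.measurable_x i
        rw [← lintegral_finsetSum]
        · refine lintegral_congr fun ω => ?_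
          rw [← lintegral_finsetSum]
          intro a _
          exact (hGc a).comp (hzip.comp measurable_prodMk_left)
        · intro a _
          exact (((hGc a).comp hzip).lintegral_prod_right').comp hx
    _ = IsPoissonPP.weight p.userIntensity n *
          ∫⁻ x, H x ∂(Measure.pi fun _ : Fin n => p.userIntensity) :=
        IsPoissonPP.setLIntegral_eq_of_symmetric (μ := p.userIntensity) hS.measurable_N
          hS.measurable_x hS.poisson hH hHs
    _ = IsPoissonPP.weight p.userIntensity n *
          ∫⁻ q, T q ∂Measure.pi fun _ => p.markedIntensity := by
        rw [← lintegral_prod (fun b : (Fin n → Plane) × (Fin n → Plane × ℝ) =>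
          T fun i => (b.1 i, b.2 i)) hTz.aemeasurable,
          ← hmp.lintegral_comp_emb (MeasurableEquiv.measurableEmbedding _)]
        rfl
    _ = _ := by
        rw [lintegral_finsetSum _ fun a _ => hGc a]

end IsModel
end Network

/-! ### The Campbell–Mecke formula for the receivers -/

namespace Params

variable (p : Params)

lemma measurable_sirOf_comp {n : ℕ} {f : (Fin n → MarkedUser) → Plane} (hf : Measurable f)
    {t : (Fin n → MarkedUser) → ℝ} (ht : Measurable t) :
    Measurable fun a : (Fin n → MarkedUser) × (Plane × ℝ × ℝ) => p.sirOf (f a.1) (t a.1) a.2 := by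
  have h : Measurable fun a : (Fin n → MarkedUser) × (Plane × ℝ × ℝ) => (f a.1, t a.1, a.2) :=
    (hf.comp measurable_fst).prodMk ((ht.comp measurable_fst).prodMk measurable_snd)
  simpa only [Function.comp_def] using p.measurable_sirOf.comp h

end Params

namespace Network

variable {Ω : Type*} (S : Network Ω)

/-- The SIR at a typical receiver located at `v`, with the gains of the `j`-th receiver in place of
fresh ones. -/
def typicalSIR (p : Params) (j : ℕ) (v : Plane) (ω : Ω) : ℝ :=
  S.g0 j ω * p.ρD / S.typicalInterference p v ω (S.gz j ω) fun k => S.g k j ω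

namespace IsModel

variable {S} [MeasurableSpace Ω] {P : Measure Ω} [IsProbabilityMeasure P] {p : Params}
  (hS : S.IsModel p P)

omit [MeasurableSpace Ω] in
lemma typicalSIR_eq (j n : ℕ) (v : Plane) (ω : Ω) (h : S.N ω = n) :
    S.typicalSIR p j v ω =
      p.sirOf v (∑ i : Fin n, p.userInterference v (S.markedUser j i ω)) (S.cueRef j ω) := by
  subst h
  unfold typicalSIR typicalInterference
  rw [Finset.sum_range]
  rfl

omit [MeasurableSpace Ω] in
lemma SIR_eq (n : ℕ) (j : Fin n) (ω : Ω) (h : S.N ω = n) :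
    S.SIR p j ω =
      p.sirOf (S.y j ω) (∑ i ∈ Finset.univ.erase j, p.userInterference (S.y j ω)
        (S.markedUser j i ω)) (S.cueRef j ω) := by
  subst h
  unfold SIR interference
  rw [sum_range_erase_eq]
  rfl

include hS

lemma lintegral_indicator_typicalSIR (j : ℕ) (v : Plane) {A : Set ℝ} (hA : MeasurableSet A) :
    ∫⁻ ω, A.indicator 1 (S.typicalSIR p j v ω) ∂P = p.typicalProb A v := by
  rw [lintegral_eq_tsum_setLIntegral P hS.measurable_N, Params.typicalProb]
  congr 1
  funext n
  have ht : Measurable fun q : Fin n → MarkedUser => ∑ i, p.userInterference v (q i) := by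
    simpa only [Function.comp_def] using
      (p.measurable_sum_userInterference n).comp (measurable_prodMk_left (x := v))
  have hG : Measurable fun a : (Fin n → MarkedUser) × (Plane × ℝ × ℝ) =>
      A.indicator (1 : ℝ → ℝ≥0∞) (p.sirOf v (∑ i, p.userInterference v (a.1 i)) a.2) := by
    simpa only [Function.comp_def] using
    (measurable_one.indicator hA).comp (p.measurable_sirOf_comp measurable_const ht)
  have h := hS.sum_setLIntegral_eq (n := n) (fun _ : Unit => j) (fun _ => hG) fun σ q => by
    simp only [Finset.univ_unique, Finset.sum_singleton]
    rw [Equiv.sum_comp σ fun i => p.userInterference v (q i)]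
  simp only [Finset.univ_unique, Finset.sum_singleton, p.lintegral_indicator_sirOf hA] at h
  rw [← h]
  refine setLIntegral_congr_fun (hS.measurable_N (measurableSet_singleton n)) fun ω hω => ?_
  simp only [typicalSIR_eq j n v ω hω]

/-- The Campbell–Mecke formula for the receivers, weighted by an arbitrary function of the location
of the user and the displacement. From the `j`-th receiver the rest of the network looks like the
whole network from a typical receiver. The sum over the `n + 1` choices of `j` turns the Poisson
weight of `n + 1` points into that of the `n` remaining ones. -/
lemma lintegral_sum_range_eq {w : Plane × Plane → ℝ≥0∞} (hw : Measurable w) {A : Set ℝ}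
    (hA : MeasurableSet A) :
    ∫⁻ ω, ∑ j ∈ Finset.range (S.N ω), w (S.x j ω, S.u j ω) * A.indicator 1 (S.SIR p j ω) ∂P =
      ∫⁻ q, w q * p.typicalProb A (q.1 + q.2) ∂p.userIntensity.prod p.displacementLaw := by
  let y : MarkedUser → Plane := fun q => q.1 + q.2.1
  have hy : Measurable y := measurable_fst.add (measurable_fst.comp measurable_snd)
  let w' : MarkedUser → ℝ≥0∞ := fun q => w (q.1, q.2.1)
  have hw' : Measurable w' :=
    hw.comp (measurable_fst.prodMk (measurable_fst.comp measurable_snd))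
  let J : ℕ → ℝ≥0∞ := fun n => ∫⁻ q, w' q * ∫⁻ r : Fin n → MarkedUser,
    p.sirProb A (y q) (∑ i, p.userInterference (y q) (r i))
      ∂(Measure.pi fun _ => p.markedIntensity) ∂p.markedIntensity
  have hJ : ∀ n, Measurable fun q : MarkedUser => ∫⁻ r : Fin n → MarkedUser,
      p.sirProb A (y q) (∑ i, p.userInterference (y q) (r i))
      ∂(Measure.pi fun _ => p.markedIntensity) := by
    intro n
    have := ((p.measurable_sirProb_sum hA n).lintegral_prod_right'
      (ν := Measure.pi fun _ => p.markedIntensity)).comp hy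
    simpa only [Function.comp_def] using this
  have key : ∀ n, ∫⁻ ω in {ω | S.N ω = n + 1},
      ∑ j ∈ Finset.range (S.N ω), w (S.x j ω, S.u j ω) * A.indicator 1 (S.SIR p j ω) ∂P =
        IsPoissonPP.weight p.userIntensity n * J n := by
    intro n
    let t : Fin (n + 1) → (Fin (n + 1) → MarkedUser) → ℝ := fun j q =>
      ∑ k ∈ Finset.univ.erase j, p.userInterference (y (q j)) (q k)
    have ht : ∀ j, Measurable (t j) := fun j => Finset.measurable_sum _ fun k _ => by
      have h : Measurable fun q : Fin (n + 1) → MarkedUser => (y (q j), q k) :=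
        (hy.comp (measurable_pi_apply j)).prodMk (measurable_pi_apply k)
      simpa only [Function.comp_def] using p.measurable_userInterference.comp h
    let G : Fin (n + 1) → (Fin (n + 1) → MarkedUser) × (Plane × ℝ × ℝ) → ℝ≥0∞ := fun j a =>
      w' (a.1 j) * A.indicator 1 (p.sirOf (y (a.1 j)) (t j a.1) a.2)
    have hG : ∀ j, Measurable (G j) := by
      intro j
      refine Measurable.mul ?_ ?_
      · exact hw'.comp ((measurable_pi_apply j).comp measurable_fst)
      · simpa only [Function.comp_def] using (measurable_one.indicator hA).comp
          (p.measurable_sirOf_comp (hy.comp (measurable_pi_apply j)) (ht j))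
    have hGi : ∀ j q, ∫⁻ c, G j (q, c) ∂p.cueRefLaw =
        w' (q j) * p.sirProb A (y (q j)) (t j q) := by
      intro j q
      have hm : Measurable fun c => A.indicator (1 : ℝ → ℝ≥0∞) (p.sirOf (y (q j)) (t j q) c) := by
        have h : Measurable fun c : Plane × ℝ × ℝ => (y (q j), t j q, c) := by fun_prop
        simpa only [Function.comp_def] using
          (measurable_one.indicator hA).comp (p.measurable_sirOf.comp h)
      rw [← p.lintegral_indicator_sirOf hA, ← lintegral_const_mul _ hm]
    have h := hS.sum_setLIntegral_eq (n := n + 1) (fun j : Fin (n + 1) => (j : ℕ)) hG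
      fun σ q => by
        simp only [hGi]
        rw [← Equiv.sum_comp σ fun j => w' (q j) * p.sirProb A (y (q j)) (t j q)]
        refine Finset.sum_congr rfl fun j _ => ?_
        simp only [t]
        rw [sum_erase_perm (fun k => p.userInterference (y (q (σ j))) (q k)) j σ]
    have hj : ∀ j, ∫⁻ q, ∫⁻ c, G j (q, c) ∂p.cueRefLaw ∂Measure.pi (fun _ => p.markedIntensity) =
        J n := by
      intro j
      simp only [hGi]
      have hmp := measurePreserving_piFinSuccAbove (fun _ : Fin (n + 1) => p.markedIntensity) j
      let F : MarkedUser × (Fin n → MarkedUser) → ℝ≥0∞ := fun b =>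
        w' b.1 * p.sirProb A (y b.1) (∑ i, p.userInterference (y b.1) (b.2 i))
      have hFm : Measurable F := by
        refine (hw'.comp measurable_fst).mul ?_
        have h : Measurable fun b : MarkedUser × (Fin n → MarkedUser) => (y b.1, b.2) :=
          (hy.comp measurable_fst).prodMk measurable_snd
        simpa only [Function.comp_def] using (p.measurable_sirProb_sum hA n).comp h
      calc ∫⁻ q, w' (q j) * p.sirProb A (y (q j)) (t j q) ∂Measure.pi (fun _ => p.markedIntensity)
          = ∫⁻ q, F (MeasurableEquiv.piFinSuccAbove (fun _ : Fin (n + 1) => MarkedUser) j q)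
              ∂Measure.pi (fun _ => p.markedIntensity) := by
            refine lintegral_congr fun q => ?_
            simp only [t]
            rw [sum_erase_eq_sum_succAbove]
            rfl
        _ = ∫⁻ b, F b ∂(p.markedIntensity.prod (Measure.pi fun _ => p.markedIntensity)) :=
            hmp.lintegral_comp hFm
        _ = J n := by
            rw [lintegral_prod _ hFm.aemeasurable]
            refine lintegral_congr fun q => ?_
            simp only [F]
            rw [lintegral_const_mul]
            have h : Measurable fun r : Fin n → MarkedUser => (y q, r) := measurable_prodMk_left
            simpa only [Function.comp_def] using (p.measurable_sirProb_sum hA n).comp h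
    simp only [hj, Finset.sum_const, Finset.card_univ, Fintype.card_fin, nsmul_eq_mul] at h
    have hweight : IsPoissonPP.weight p.userIntensity n =
        IsPoissonPP.weight p.userIntensity (n + 1) * ((n + 1 : ℕ) : ℝ≥0∞) := by
      have h0 : ((n + 1 : ℕ) : ℝ≥0∞) ≠ 0 := by exact_mod_cast Nat.succ_ne_zero n
      rw [IsPoissonPP.weight, IsPoissonPP.weight, Nat.factorial_succ, Nat.cast_mul,
        ← ENNReal.mul_div_right_comm, mul_comm ((n + 1 : ℕ) : ℝ≥0∞),
        ENNReal.mul_div_mul_right _ _ h0 (ENNReal.natCast_ne_top _)]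
    rw [hweight, mul_assoc, ← h, ← lintegral_finsetSum]
    · refine setLIntegral_congr_fun (hS.measurable_N (measurableSet_singleton (n + 1)))
        fun ω hω => ?_
      have hω' : S.N ω = n + 1 := hω
      simp only [hω', Finset.sum_range]
      refine Finset.sum_congr rfl fun j _ => ?_
      rw [SIR_eq (n + 1) j ω hω']
      rfl
    · intro j _
      exact (hG j).comp ((measurable_pi_lambda _ fun i : Fin (n + 1) =>
        hS.measurable_markedUser j i).prodMk (hS.measurable_cueRef j))
  have hzero : ∫⁻ ω in {ω | S.N ω = 0},
      ∑ j ∈ Finset.range (S.N ω), w (S.x j ω, S.u j ω) * A.indicator 1 (S.SIR p j ω) ∂P = 0 := by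
    refine (setLIntegral_congr_fun (g := fun _ => 0) (hS.measurable_N (measurableSet_singleton 0))
      fun ω hω => ?_).trans (by simp)
    have hω' : S.N ω = 0 := hω
    simp [hω']
  rw [lintegral_eq_tsum_setLIntegral P hS.measurable_N, tsum_eq_zero_add' ENNReal.summable, hzero,
    zero_add]
  simp only [key]
  have hmp : MeasurePreserving (Prod.map id Prod.fst : MarkedUser → Plane × Plane)
      p.markedIntensity (p.userIntensity.prod p.displacementLaw) :=
    (MeasurePreserving.id _).prod measurePreserving_fst
  have hR : Measurable fun q : Plane × Plane => w q * p.typicalProb A (q.1 + q.2) :=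
    hw.mul ((p.measurable_typicalProb hA).comp (measurable_fst.add measurable_snd))
  rw [← hmp.lintegral_comp hR]
  let W : ℕ → MarkedUser → ℝ≥0∞ := fun n q => w' q * ∫⁻ r : Fin n → MarkedUser,
      p.sirProb A (y q) (∑ i, p.userInterference (y q) (r i))
      ∂(Measure.pi fun _ => p.markedIntensity)
  have hW : ∀ n, Measurable (W n) := fun n => hw'.mul (hJ n)
  calc ∑' n, IsPoissonPP.weight p.userIntensity n * J n
      = ∑' n, ∫⁻ q, IsPoissonPP.weight p.userIntensity n * W n q ∂p.markedIntensity :=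
        tsum_congr fun n => (lintegral_const_mul _ (hW n)).symm
    _ = ∫⁻ q, ∑' n, IsPoissonPP.weight p.userIntensity n * W n q ∂p.markedIntensity :=
        (lintegral_tsum fun n => ((hW n).const_mul _).aemeasurable).symm
    _ = _ := by
        refine lintegral_congr fun q => ?_
        rw [Params.typicalProb, ← ENNReal.tsum_mul_left]
        exact tsum_congr fun n => mul_left_comm _ _ _

end IsModel
end Network

/-! ### The SIR at a typical receiver -/

namespace Params

variable (p : Params)

instance : NullSingletonClass p.refGainLaw :=
  ⟨fun _ => withDensity_absolutelyContinuous _ _ Real.volume_singleton⟩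

lemma sirProb_singleton (v : Plane) (t : ℝ) {r : ℝ} (hr : r ≠ 0) : p.sirProb {r} v t = 0 := by
  have hm : Measurable fun c : Plane × ℝ × ℝ => p.sirOf v t c := by
    have h : Measurable fun c : Plane × ℝ × ℝ => (v, t, c) := by fun_prop
    simpa only [Function.comp_def] using p.measurable_sirOf.comp h
  have hs : MeasurableSet {c | p.sirOf v t c ∈ ({r} : Set ℝ)} := hm (measurableSet_singleton r)
  rw [sirProb, cueRefLaw, Measure.prod_apply hs]
  refine (lintegral_congr fun z => ?_).trans lintegral_zero
  rw [Measure.prod_apply_symm (hs.preimage measurable_prodMk_left)]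
  refine (lintegral_congr fun gz => ?_).trans lintegral_zero
  refine Set.Subsingleton.measure_zero (fun a ha b hb => ?_) _
  -- the reference gain is determined by the SIR: `r ≠ 0` excludes a vanishing interference, for
  -- which the SIR would be the junk value `0`
  have ha' : a * p.ρD / (p.cueInterference gz z v + t) = r := ha
  have hb' : b * p.ρD / (p.cueInterference gz z v + t) = r := hb
  have h0 : p.cueInterference gz z v + t ≠ 0 := by
    intro h
    rw [h, div_zero] at ha'
    exact hr ha'.symm
  rw [← hb', div_left_inj' h0] at ha'
  exact mul_right_cancel₀ p.ρD_pos.ne' ha'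

lemma typicalProb_singleton (v : Plane) {r : ℝ} (hr : r ≠ 0) : p.typicalProb {r} v = 0 := by
  simp [typicalProb, p.sirProb_singleton v _ hr]

/-- The SIR at a typical receiver located at `v` as a function of the locations in the network and
of the gains at the receiver. -/
def sirOfGeometry (v : Plane)
    (a : ((ℕ × (ℕ → Plane)) × (ℕ → Plane) × Plane) × (ℝ × ℝ × (ℕ → ℝ))) : ℝ :=
  a.2.1 * p.ρD / (p.cueInterference a.2.2.1 a.1.2.2 v +
    ∑ k ∈ Finset.range a.1.1.1, p.d2dInterference (a.2.2.2 k) (a.1.1.2 k)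
      (a.1.1.2 k + a.1.2.1 k) v)

lemma measurable_sirOfGeometry (v : Plane) : Measurable (p.sirOfGeometry v) := by
  unfold sirOfGeometry
  have h1 : Measurable fun a : ((ℕ × (ℕ → Plane)) × (ℕ → Plane) × Plane) × (ℝ × ℝ × (ℕ → ℝ)) =>
      p.cueInterference a.2.2.1 a.1.2.2 v := by
    have h : Measurable fun a : ((ℕ × (ℕ → Plane)) × (ℕ → Plane) × Plane) × (ℝ × ℝ × (ℕ → ℝ)) =>
      (a.2.2.1, a.1.2.2, v) := by fun_prop
    simpa only [Function.comp_def] using p.measurable_cueInterference.comp h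
  have h2 : Measurable fun a : ((ℕ × (ℕ → Plane)) × (ℕ → Plane) × Plane) × (ℝ × ℝ × (ℕ → ℝ)) =>
      ∑ k ∈ Finset.range a.1.1.1, p.d2dInterference (a.2.2.2 k) (a.1.1.2 k)
      (a.1.1.2 k + a.1.2.1 k) v := by
    refine measurable_sum_range (by fun_prop) fun k => ?_
    have h : Measurable fun a : ((ℕ × (ℕ → Plane)) × (ℕ → Plane) × Plane) × (ℝ × ℝ × (ℕ → ℝ)) =>
      (a.2.2.2 k, a.1.1.2 k, a.1.1.2 k + a.1.2.1 k, v) := by fun_prop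
    simpa only [Function.comp_def] using p.measurable_d2dInterference.comp h
  fun_prop

section Isometry

variable (O : Plane ≃ₗᵢ[ℝ] Plane)

lemma measurePreserving_cond_closedBall (r : ℝ) :
    MeasurePreserving O ((volume : Measure Plane)[|Metric.closedBall 0 r])
      ((volume : Measure Plane)[|Metric.closedBall 0 r]) := by
  have h := (O.measurePreserving.restrict_preimage
    (measurableSet_closedBall (x := (0 : Plane)) (ε := r))).smul_measure
      (volume (Metric.closedBall (0 : Plane) r))⁻¹
  have hO : O ⁻¹' Metric.closedBall 0 r = Metric.closedBall 0 r := by ext v; simp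
  rwa [hO] at h

lemma measurePreserving_userIntensity :
    MeasurePreserving O p.userIntensity p.userIntensity := by
  have h := (O.measurePreserving.restrict_preimage
    (measurableSet_closedBall (x := (0 : Plane)) (ε := p.R))).smul_measure (ENNReal.ofReal p.lam)
  have hO : O ⁻¹' Metric.closedBall 0 p.R = Metric.closedBall 0 p.R := by ext v; simp
  rwa [hO] at h

lemma measurePreserving_markedIntensity :
    MeasurePreserving (Prod.map O (Prod.map O id)) p.markedIntensity p.markedIntensity :=
  (p.measurePreserving_userIntensity O).prod
    ((measurePreserving_cond_closedBall O p.RD).prod (MeasurePreserving.id _))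

lemma measurePreserving_cueRefLaw :
    MeasurePreserving (Prod.map O id) p.cueRefLaw p.cueRefLaw :=
  (measurePreserving_cond_closedBall O p.R).prod (MeasurePreserving.id _)

lemma underlay_map (x y : Plane) : p.Underlay (O x) (O y) ↔ p.Underlay x y := by
  simp [Underlay, ← map_sub]

lemma userInterference_map (v : Plane) (q : MarkedUser) :
    p.userInterference (O v) (Prod.map O (Prod.map O id) q) = p.userInterference v q := by
  have h := p.underlay_map O q.1 (q.1 + q.2.1)
  rw [map_add] at h
  unfold userInterference d2dInterference
  simp only [Prod.map, id]
  by_cases hU : p.Underlay q.1 (q.1 + q.2.1)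
  · rw [if_pos hU, if_pos (h.2 hU)]
    simp only [← map_add, ← map_sub, LinearIsometryEquiv.norm_map]
  · rw [if_neg hU, if_neg (mt h.1 hU)]

lemma sirProb_map {A : Set ℝ} (hA : MeasurableSet A) (v : Plane) (t : ℝ) :
    p.sirProb A (O v) t = p.sirProb A v t := by
  have hm : Measurable fun c : Plane × ℝ × ℝ => p.sirOf (O v) t c := by
    have h : Measurable fun c : Plane × ℝ × ℝ => (O v, t, c) := by fun_prop
    simpa only [Function.comp_def] using p.measurable_sirOf.comp h
  have hs : MeasurableSet {c | p.sirOf (O v) t c ∈ A} := hm hA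
  rw [sirProb, ← (p.measurePreserving_cueRefLaw O).measure_preimage hs.nullMeasurableSet, sirProb]
  congr 1
  ext c
  simp [sirOf, cueInterference, ← map_sub]

lemma typicalProb_map {A : Set ℝ} (hA : MeasurableSet A) (v : Plane) :
    p.typicalProb A (O v) = p.typicalProb A v := by
  unfold typicalProb
  refine tsum_congr fun n => ?_
  congr 1
  have hmp := measurePreserving_pi (fun _ : Fin n => p.markedIntensity)
    (fun _ : Fin n => p.markedIntensity) fun _ => p.measurePreserving_markedIntensity O
  have hm : Measurable fun q : Fin n → MarkedUser =>
      p.sirProb A (O v) (∑ i, p.userInterference (O v) (q i)) := by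
    simpa only [Function.comp_def] using
      (p.measurable_sirProb_sum hA n).comp (measurable_prodMk_left (x := O v))
  rw [← hmp.lintegral_comp hm]
  refine lintegral_congr fun q => ?_
  simp only [p.userInterference_map, p.sirProb_map O hA]

end Isometry

lemma exists_isometry_apply_eq (v : Plane) : ∃ O : Plane ≃ₗᵢ[ℝ] Plane, O !₂[‖v‖, 0] = v := by
  refine ⟨_, Submodule.reflection_sub ?_⟩
  simp [EuclideanSpace.norm_eq]

lemma typicalProb_eq_of_norm {A : Set ℝ} (hA : MeasurableSet A) (v : Plane) :
    p.typicalProb A v = p.typicalProb A !₂[‖v‖, 0] := by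
  obtain ⟨O, hO⟩ := exists_isometry_apply_eq v
  conv_lhs => rw [← hO]
  exact p.typicalProb_map O hA _

end Params

namespace Network

variable {Ω : Type*} (S : Network Ω)

namespace IsModel

variable {S} [MeasurableSpace Ω] {P : Measure Ω} [IsProbabilityMeasure P] {p : Params}
  (hS : S.IsModel p P)

include hS

omit [IsProbabilityMeasure P] in
lemma measurable_typicalSIR (j : ℕ) (v : Plane) : Measurable (S.typicalSIR p j v) :=
  (p.measurable_sirOfGeometry v).comp (hS.measurable_geometry.prodMk (hS.measurable_gains j))

lemma outageAt_eq (v : Plane) :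
    S.outageAt p P v = (p.typicalProb (Set.Iio p.γ) v).toReal := by
  have hs : MeasurableSet {a | p.sirOfGeometry v a < p.γ} :=
    (p.measurable_sirOfGeometry v) measurableSet_Iio
  rw [outageAt, measureReal_def]
  congr 1
  have := Measure.isProbabilityMeasure_map (μ := P) hS.measurable_geometry.aemeasurable
  have := isProbabilityMeasure_gammaMeasure p.m_pos p.m_pos
  calc (P.prod ((gammaMeasure p.m p.m).prod
        ((expMeasure 1).prod (Measure.infinitePi fun _ : ℕ => expMeasure 1))))
        {w | w.2.1 * p.ρD / S.typicalInterference p v w.1 w.2.2.1 w.2.2.2 < p.γ}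
      = ((P.prod ((gammaMeasure p.m p.m).prod
        ((expMeasure 1).prod (Measure.infinitePi fun _ : ℕ => expMeasure 1)))).map
          (Prod.map S.geometry id)) {a | p.sirOfGeometry v a < p.γ} := by
        rw [Measure.map_apply (hS.measurable_geometry.prodMap measurable_id) hs]
        rfl
    _ = P.map (fun ω => (S.geometry ω, S.gains 0 ω)) {a | p.sirOfGeometry v a < p.γ} := by
        rw [hS.map_geometry_gains, ← Measure.map_prod_map _ _ hS.measurable_geometry measurable_id,
          Measure.map_id, Params.refGainLaw]
    _ = ∫⁻ ω, (Set.Iio p.γ).indicator 1 (S.typicalSIR p 0 v ω) ∂P := by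
        rw [Measure.map_apply (hS.measurable_geometry.prodMk (hS.measurable_gains 0)) hs,
          ← lintegral_indicator_one
            ((hS.measurable_geometry.prodMk (hS.measurable_gains 0)) hs)]
        rfl
    _ = _ := hS.lintegral_indicator_typicalSIR 0 v measurableSet_Iio

lemma typicalProb_univ (v : Plane) : p.typicalProb Set.univ v = 1 := by
  rw [← hS.lintegral_indicator_typicalSIR 0 v MeasurableSet.univ]
  simp

lemma typicalProb_Iio_add_Ioi (v : Plane) :
    p.typicalProb (Set.Iio p.γ) v + p.typicalProb (Set.Ioi p.γ) v = 1 := by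
  have hm := hS.measurable_typicalSIR 0 v
  rw [← hS.typicalProb_univ v, ← add_zero (p.typicalProb (Set.Iio p.γ) v),
    ← p.typicalProb_singleton v p.γ_pos.ne',
    ← hS.lintegral_indicator_typicalSIR 0 v measurableSet_Iio,
    ← hS.lintegral_indicator_typicalSIR 0 v measurableSet_Ioi,
    ← hS.lintegral_indicator_typicalSIR 0 v (measurableSet_singleton _),
    ← hS.lintegral_indicator_typicalSIR 0 v MeasurableSet.univ, ← lintegral_add_left,
    ← lintegral_add_left]
  · refine lintegral_congr fun ω => ?_
    rcases lt_trichotomy (S.typicalSIR p 0 v ω) p.γ with h | h | h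
    · simp [h, h.ne, h.not_gt]
    · simp [h]
    · simp [h, h.ne', h.not_gt]
  · exact ((measurable_one.indicator measurableSet_Iio).comp hm).add
      ((measurable_one.indicator (measurableSet_singleton _)).comp hm)
  · exact (measurable_one.indicator measurableSet_Iio).comp hm

lemma ofReal_outageAt (v : Plane) :
    ENNReal.ofReal (S.outageAt p P v) = p.typicalProb (Set.Iio p.γ) v := by
  rw [hS.outageAt_eq, ENNReal.ofReal_toReal]
  have h := hS.typicalProb_Iio_add_Ioi v
  exact ne_top_of_le_ne_top ENNReal.one_ne_top (h ▸ le_self_add)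

lemma ofReal_one_sub_outageAt (v : Plane) :
    ENNReal.ofReal (1 - S.outageAt p P v) = p.typicalProb (Set.Ioi p.γ) v := by
  rw [ENNReal.ofReal_sub _ (show 0 ≤ S.outageAt p P v from measureReal_nonneg),
    hS.ofReal_outageAt, ENNReal.ofReal_one,
    ← hS.typicalProb_Iio_add_Ioi v]
  refine ENNReal.add_sub_cancel_left ?_
  have h := hS.typicalProb_Iio_add_Ioi v
  exact ne_top_of_le_ne_top ENNReal.one_ne_top (h ▸ le_self_add)

lemma outageAt_eq_outage (v : Plane) : S.outageAt p P v = S.outage p P ‖v‖ := by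
  rw [outage, hS.outageAt_eq, hS.outageAt_eq, p.typicalProb_eq_of_norm measurableSet_Iio v]

lemma measurable_outage : Measurable (S.outage p P) := by
  have h : Measurable fun d : ℝ => (p.typicalProb (Set.Iio p.γ) !₂[d, 0]).toReal := by
    refine ((p.measurable_typicalProb measurableSet_Iio).comp ?_).ennreal_toReal
    fun_prop
  convert! h using 1
  funext d
  exact hS.outageAt_eq _

end IsModel
end Network

/-! ### Intensity measures of the receivers -/

namespace Network

variable {Ω : Type*} (S : Network Ω)

open Classical in
/-- The point process of the receivers for which the location of the user and the displacement lie
in `U` and the SIR lies in `A`. -/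
def selectedReceivers (p : Params) (U : Set (Plane × Plane)) (A : Set ℝ) (ω : Ω) : Measure Plane :=
  ∑ k ∈ (Finset.range (S.N ω)).filter fun k => (S.x k ω, S.u k ω) ∈ U ∧ S.SIR p k ω ∈ A,
    Measure.dirac (S.y k ω)

lemma receiverPoints_eq (p : Params) :
    S.receiverPoints = S.selectedReceivers p Set.univ Set.univ := by
  funext ω
  simp [receiverPoints, selectedReceivers]

lemma mem_underlayIndices (p : Params) (ω : Ω) (k : ℕ) :
    k ∈ S.underlayIndices p ω ↔ k < S.N ω ∧ p.Underlay (S.x k ω) (S.y k ω) := by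
  classical
  unfold underlayIndices
  rw [Finset.mem_filter, Finset.mem_range]

lemma underlayReceiverPoints_eq (p : Params) :
    S.underlayReceiverPoints p =
      S.selectedReceivers p {q | p.Underlay q.1 (q.1 + q.2)} Set.univ := by
  funext ω
  refine Finset.sum_congr ?_ fun _ _ => rfl
  ext k
  simp [mem_underlayIndices, y]

lemma outageReceiverPoints_eq (p : Params) :
    S.outageReceiverPoints p =
      S.selectedReceivers p {q | p.Underlay q.1 (q.1 + q.2)} (Set.Iio p.γ) := by
  funext ω
  refine Finset.sum_congr ?_ fun _ _ => rfl
  ext k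
  simp [mem_underlayIndices, y, and_assoc]

lemma successCount_eq (p : Params) (ω : Ω) :
    (S.successCount p ω : ℝ≥0∞) = ∑ k ∈ Finset.range (S.N ω),
      {q : Plane × Plane | p.Underlay q.1 (q.1 + q.2)}.indicator 1 (S.x k ω, S.u k ω) *
        (Set.Ioi p.γ).indicator 1 (S.SIR p k ω) := by
  classical
  rw [successCount, underlayIndices, Finset.filter_filter, Finset.card_filter, Nat.cast_sum]
  refine Finset.sum_congr rfl fun k _ => ?_
  by_cases h1 : p.Underlay (S.x k ω) (S.x k ω + S.u k ω) <;> by_cases h2 : p.γ < S.SIR p k ω <;>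
    simp [h1, h2, y]

lemma selectedReceivers_apply (p : Params) (U : Set (Plane × Plane)) (A : Set ℝ) (ω : Ω)
    {B : Set Plane} (hB : MeasurableSet B) :
    S.selectedReceivers p U A ω B = ∑ k ∈ Finset.range (S.N ω),
      (U.indicator 1 (S.x k ω, S.u k ω) * B.indicator 1 (S.x k ω + S.u k ω)) *
        A.indicator 1 (S.SIR p k ω) := by
  classical
  rw [selectedReceivers, Measure.finsetSum_apply, Finset.sum_filter]
  refine Finset.sum_congr rfl fun k _ => ?_
  rw [Measure.dirac_apply' _ hB]
  by_cases h1 : (S.x k ω, S.u k ω) ∈ U <;> by_cases h2 : S.SIR p k ω ∈ A <;>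
    simp [h1, h2, y]

namespace IsModel

variable {S} [MeasurableSpace Ω] {P : Measure Ω} [IsProbabilityMeasure P] {p : Params}
  (hS : S.IsModel p P)
include hS

omit [IsProbabilityMeasure P] in
lemma measurable_y (k : ℕ) : Measurable (S.y k) := (hS.measurable_x k).add (hS.measurable_u k)

omit [IsProbabilityMeasure P] in
lemma measurable_SIR (j : ℕ) : Measurable (S.SIR p j) := by
  unfold SIR interference
  have h0 : Measurable fun ω => (S.gz j ω, S.z ω, S.y j ω) :=
    (hS.measurable_gz j).prodMk (hS.measurable_z.prodMk (hS.measurable_y j))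
  have h1 := p.measurable_cueInterference.comp h0
  have h2 : ∀ k, Measurable fun ω =>
      p.d2dInterference (S.g k j ω) (S.x k ω) (S.y k ω) (S.y j ω) := by
    intro k
    have h : Measurable fun ω => (S.g k j ω, S.x k ω, S.y k ω, S.y j ω) :=
      (hS.measurable_g k j).prodMk ((hS.measurable_x k).prodMk
        ((hS.measurable_y k).prodMk (hS.measurable_y j)))
    simpa only [Function.comp_def] using p.measurable_d2dInterference.comp h
  simp only [Function.comp_def] at h1
  exact ((hS.measurable_g0 j).mul_const _).div
    (h1.add (measurable_sum_range_erase hS.measurable_N h2 j))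

omit [IsProbabilityMeasure P] in
lemma measurable_sum_weights {w : Plane × Plane → ℝ≥0∞} (hw : Measurable w) {A : Set ℝ}
    (hA : MeasurableSet A) :
    Measurable fun ω => ∑ k ∈ Finset.range (S.N ω),
      w (S.x k ω, S.u k ω) * A.indicator 1 (S.SIR p k ω) :=
  measurable_sum_range hS.measurable_N fun k =>
    (hw.comp ((hS.measurable_x k).prodMk (hS.measurable_u k))).mul
      ((measurable_one.indicator hA).comp (hS.measurable_SIR k))

omit hS [MeasurableSpace Ω] [IsProbabilityMeasure P] in
lemma measurable_weight {U : Set (Plane × Plane)}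
    (hU : MeasurableSet U) {B : Set Plane} (hB : MeasurableSet B) :
    Measurable fun q : Plane × Plane =>
      U.indicator (1 : Plane × Plane → ℝ≥0∞) q * B.indicator 1 (q.1 + q.2) :=
  (measurable_one.indicator hU).mul
    ((measurable_one.indicator hB).comp (measurable_fst.add measurable_snd))

lemma intensity_selectedReceivers_apply {U : Set (Plane × Plane)} (hU : MeasurableSet U)
    {A : Set ℝ} (hA : MeasurableSet A) {B : Set Plane} (hB : MeasurableSet B) :
    intensity P (S.selectedReceivers p U A) B =
      ∫⁻ q, U.indicator 1 q * B.indicator 1 (q.1 + q.2) * p.typicalProb A (q.1 + q.2)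
        ∂p.userIntensity.prod p.displacementLaw := by
  have hm : Measurable (S.selectedReceivers p U A) := by
    refine Measure.measurable_of_measurable_coe _ fun B hB => ?_
    simp only [S.selectedReceivers_apply p U A _ hB]
    exact hS.measurable_sum_weights (measurable_weight hU hB) hA
  rw [intensity, Measure.bind_apply hB hm.aemeasurable,
    ← hS.lintegral_sum_range_eq (measurable_weight hU hB) hA]
  exact lintegral_congr fun ω => S.selectedReceivers_apply p U A ω hB

lemma intensity_selectedReceivers {U : Set (Plane × Plane)} (hU : MeasurableSet U)
    {A : Set ℝ} (hA : MeasurableSet A) :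
    intensity P (S.selectedReceivers p U A) =
      (((p.userIntensity.prod p.displacementLaw).restrict U).map fun q => q.1 + q.2).withDensity
        (p.typicalProb A) := by
  have hadd : Measurable fun q : Plane × Plane => q.1 + q.2 := measurable_fst.add measurable_snd
  ext B hB
  rw [hS.intensity_selectedReceivers_apply hU hA hB, withDensity_apply _ hB,
    setLIntegral_map hB (p.measurable_typicalProb hA) hadd, ← lintegral_indicator (hadd hB),
    ← lintegral_indicator hU]
  refine lintegral_congr fun q => ?_
  by_cases h1 : q ∈ U <;> by_cases h2 : q.1 + q.2 ∈ B <;> simp [h1, h2]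

lemma intensity_selectedReceivers_univ {U : Set (Plane × Plane)} (hU : MeasurableSet U) :
    intensity P (S.selectedReceivers p U Set.univ) =
      ((p.userIntensity.prod p.displacementLaw).restrict U).map fun q => q.1 + q.2 := by
  rw [hS.intensity_selectedReceivers hU MeasurableSet.univ]
  have : p.typicalProb Set.univ = 1 := funext hS.typicalProb_univ
  rw [this, withDensity_one]

end IsModel
end Network

namespace Params

variable (p : Params)

lemma measurableSet_underlay_displacement :
    MeasurableSet {q : Plane × Plane | p.Underlay q.1 (q.1 + q.2)} := by
  have h : Measurable fun q : Plane × Plane => (q.1, q.1 + q.2) :=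
    measurable_fst.prodMk (measurable_fst.add measurable_snd)
  exact h p.measurableSet_underlay

/-- The density of the intensity measure of the receivers with respect to area: the convolution of
the intensity of the users with the uniform density of the displacements. -/
def receiverDensity (v : Plane) : ℝ≥0∞ :=
  ∫⁻ x, (Metric.closedBall (0 : Plane) p.RD).indicator
    (fun _ => (volume (Metric.closedBall (0 : Plane) p.RD))⁻¹) (v - x) ∂p.userIntensity

lemma measurable_ballDensity : Measurable fun a : Plane × Plane =>
    (Metric.closedBall (0 : Plane) p.RD).indicator
      (fun _ => (volume (Metric.closedBall (0 : Plane) p.RD))⁻¹) (a.1 - a.2) :=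
  (measurable_const.indicator measurableSet_closedBall).comp
    (measurable_fst.sub measurable_snd)

lemma measurable_receiverDensity : Measurable p.receiverDensity :=
  p.measurable_ballDensity.lintegral_prod_right'

lemma map_add_eq_withDensity :
    (p.userIntensity.prod p.displacementLaw).map (fun q => q.1 + q.2) =
      volume.withDensity p.receiverDensity := by
  have hadd : Measurable fun q : Plane × Plane => q.1 + q.2 := measurable_fst.add measurable_snd
  set f : Plane → ℝ≥0∞ := (Metric.closedBall (0 : Plane) p.RD).indicator
      (fun _ => (volume (Metric.closedBall (0 : Plane) p.RD))⁻¹) with hf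
  have hfm : Measurable f := measurable_const.indicator measurableSet_closedBall
  have hν : p.displacementLaw = volume.withDensity f := by
    rw [hf, withDensity_indicator measurableSet_closedBall, withDensity_const]
    rfl
  ext B hB
  rw [Measure.map_apply hadd hB, Measure.prod_apply (hadd hB), withDensity_apply _ hB]
  have h1 : ∀ x : Plane, p.displacementLaw
      (Prod.mk x ⁻¹' ((fun q : Plane × Plane => q.1 + q.2) ⁻¹' B)) =
      ∫⁻ v in B, f (v - x) := by
    intro x
    have hBx : MeasurableSet (Prod.mk x ⁻¹' ((fun q : Plane × Plane => q.1 + q.2) ⁻¹' B)) :=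
      measurable_prodMk_left (hadd hB)
    rw [hν, withDensity_apply _ hBx, ← lintegral_indicator hBx, ← lintegral_indicator hB,
      ← lintegral_sub_right_eq_self _ x]
    refine lintegral_congr fun v => ?_
    by_cases h : v ∈ B <;> simp [Set.indicator, h]
  simp only [h1]
  rw [lintegral_lintegral_swap]
  · rfl
  · exact (hfm.comp (measurable_snd.sub measurable_fst)).aemeasurable

lemma receiverDensity_map (O : Plane ≃ₗᵢ[ℝ] Plane) (v : Plane) :
    p.receiverDensity (O v) = p.receiverDensity v := by
  unfold receiverDensity
  rw [← (p.measurePreserving_userIntensity O).lintegral_comp]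
  · refine lintegral_congr fun x => ?_
    have h : ‖O v - O x‖ = ‖v - x‖ := by rw [← map_sub, O.norm_map]
    simp [Set.indicator, h]
  · simpa only [Function.comp_def] using
      p.measurable_ballDensity.comp (measurable_prodMk_left (x := O v))

lemma receiverDensity_eq_of_norm (v : Plane) :
    p.receiverDensity v = p.receiverDensity !₂[‖v‖, 0] := by
  obtain ⟨O, hO⟩ := exists_isometry_apply_eq v
  conv_lhs => rw [← hO]
  exact p.receiverDensity_map O _

lemma receiverDensity_ne_top (v : Plane) : p.receiverDensity v ≠ ∞ := by
  refine ne_top_of_le_ne_top ?_ (lintegral_mono (g := fun _ =>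
    (volume (Metric.closedBall (0 : Plane) p.RD))⁻¹) fun x => Set.indicator_le_self _ _ _)
  rw [lintegral_const]
  exact ENNReal.mul_ne_top (ENNReal.inv_ne_top.2 (volume_closedBall_ne_zero p.RD_pos 0))
    (measure_ne_top _ _)

lemma receiverDensity_eq_zero {v : Plane} (hv : p.R + p.RD < ‖v‖) : p.receiverDensity v = 0 := by
  have hx : ∀ᵐ x ∂p.userIntensity, x ∈ p.cell :=
    Measure.ae_smul_measure (ae_restrict_mem measurableSet_closedBall) _
  refine (lintegral_congr_ae (g := fun _ => 0) ?_).trans lintegral_zero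
  filter_upwards [hx] with x hx
  refine Set.indicator_of_notMem (fun h => ?_) _
  have h1 : ‖x‖ ≤ p.R := by simpa [cell] using hx
  have h2 : ‖v - x‖ ≤ p.RD := by simpa using h
  have h3 : ‖v‖ ≤ ‖v - x‖ + ‖x‖ := by simpa using norm_add_le (v - x) x
  linarith

lemma sigmaFinite_map_norm : SigmaFinite ((volume : Measure Plane).map fun v => ‖v‖) := by
  refine ⟨⟨⟨fun n => Set.Iic (n : ℝ), fun _ => trivial, fun n => ?_, ?_⟩⟩⟩
  · rw [Measure.map_apply measurable_norm measurableSet_Iic]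
    have : (fun v : Plane => ‖v‖) ⁻¹' Set.Iic (n : ℝ) = Metric.closedBall 0 n := by
      ext v; simp
    rw [this]
    exact measure_closedBall_lt_top
  · refine Set.eq_univ_of_forall fun d => ?_
    obtain ⟨n, hn⟩ := exists_nat_ge d
    exact Set.mem_iUnion.2 ⟨n, hn⟩

end Params

namespace Network.IsModel

variable {Ω : Type*} {S : Network Ω} [MeasurableSpace Ω] {P : Measure Ω} [IsProbabilityMeasure P]
  {p : Params} (hS : S.IsModel p P)
include hS

lemma intensity_receiverPoints :
    intensity P S.receiverPoints = volume.withDensity p.receiverDensity := by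
  rw [S.receiverPoints_eq p, hS.intensity_selectedReceivers_univ MeasurableSet.univ,
    Measure.restrict_univ, p.map_add_eq_withDensity]

/-- The density of the distances of the receivers with respect to that of area, which defines
`lamDRx`, is the density of the receivers itself because the latter is radial. -/
lemma ofReal_lamDRx_norm :
    (fun v : Plane => ENNReal.ofReal (S.lamDRx P ‖v‖)) =ᵐ[volume] p.receiverDensity := by
  let l : ℝ → ℝ≥0∞ := fun d => p.receiverDensity !₂[d, 0]
  have hl : Measurable l := p.measurable_receiverDensity.comp (by fun_prop)
  have h1 : (intensity P S.receiverPoints).map (fun v => ‖v‖) =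
      ((volume : Measure Plane).map fun v => ‖v‖).withDensity l := by
    rw [hS.intensity_receiverPoints]
    ext B hB
    rw [Measure.map_apply measurable_norm hB, withDensity_apply _ (measurable_norm hB),
      withDensity_apply _ hB, setLIntegral_map hB hl measurable_norm]
    exact lintegral_congr fun v => p.receiverDensity_eq_of_norm v
  have := Params.sigmaFinite_map_norm
  have h2 := Measure.rnDeriv_withDensity ((volume : Measure Plane).map fun v => ‖v‖) hl
  rw [← h1] at h2
  filter_upwards [ae_of_ae_map measurable_norm.aemeasurable h2] with v hv
  rw [lamDRx, hv, ENNReal.ofReal_toReal (p.receiverDensity_ne_top _),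
    p.receiverDensity_eq_of_norm v]

end Network.IsModel

/-! ### The mean number of successful transmissions -/

namespace Params

variable (p : Params)

lemma measurable_norm_add : Measurable fun q : Plane × Plane => ‖q.1 + q.2‖ :=
  (measurable_fst.add measurable_snd).norm

lemma measurable_pD2D : Measurable p.pD2D :=
  (Kernel.measurable_coe _ p.measurableSet_underlay_displacement).ennreal_toReal

lemma pD2D_nonneg (d : ℝ) : 0 ≤ p.pD2D d := measureReal_nonneg

/-- Mode selection enters an expectation only through its conditional probability given the distance
of the receiver. -/
lemma lintegral_underlay_pairLaw {φ : ℝ → ℝ≥0∞} (hφ : Measurable φ) :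
    ∫⁻ q, {q : Plane × Plane | p.Underlay q.1 (q.1 + q.2)}.indicator 1 q * φ ‖q.1 + q.2‖
        ∂p.pairLaw =
      ∫⁻ q, ENNReal.ofReal (p.pD2D ‖q.1 + q.2‖) * φ ‖q.1 + q.2‖ ∂p.pairLaw := by
  have hN := measurable_norm_add
  have hU := p.measurableSet_underlay_displacement
  set U := {q : Plane × Plane | p.Underlay q.1 (q.1 + q.2)} with hUdef
  have hc := compProd_map_condDistrib (mβ := inferInstance) (μ := p.pairLaw)
    (X := fun q : Plane × Plane => ‖q.1 + q.2‖) (Y := fun q : Plane × Plane => q)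
    measurable_id'.aemeasurable
  have hF : Measurable fun b : ℝ × (Plane × Plane) =>
      U.indicator (1 : Plane × Plane → ℝ≥0∞) b.2 * φ b.1 :=
    ((measurable_one.indicator hU).comp measurable_snd).mul (hφ.comp measurable_fst)
  have h1 := congrArg (fun ρ : Measure (ℝ × (Plane × Plane)) =>
    ∫⁻ b, U.indicator (1 : Plane × Plane → ℝ≥0∞) b.2 * φ b.1 ∂ρ) hc
  beta_reduce at h1
  rw [lintegral_map hF (hN.prodMk measurable_id'), Measure.lintegral_compProd hF] at h1
  rw [← h1, ← lintegral_map (f := fun d => ENNReal.ofReal (p.pD2D d) * φ d)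
    (p.measurable_pD2D.ennreal_ofReal.mul hφ) hN]
  refine lintegral_congr fun d => ?_
  dsimp only
  rw [lintegral_mul_const _ (measurable_one.indicator hU), lintegral_indicator_one hU, pD2D,
    ofReal_measureReal]

lemma lintegral_underlay {φ : ℝ → ℝ≥0∞} (hφ : Measurable φ) :
    ∫⁻ q, {q : Plane × Plane | p.Underlay q.1 (q.1 + q.2)}.indicator 1 q * φ ‖q.1 + q.2‖
        ∂p.userIntensity.prod p.displacementLaw =
      ∫⁻ v, ENNReal.ofReal (p.pD2D ‖v‖) * φ ‖v‖ * p.receiverDensity v := by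
  have hadd : Measurable fun q : Plane × Plane => q.1 + q.2 := measurable_fst.add measurable_snd
  have h0 : p.userIntensity = (ENNReal.ofReal p.lam * volume p.cell) • volume[|p.cell] := by
    have h1 : volume p.cell ≠ 0 := volume_closedBall_ne_zero p.R_pos 0
    have h2 : volume p.cell ≠ ∞ := volume_closedBall_ne_top _ _
    rw [userIntensity, ProbabilityTheory.cond, smul_smul, mul_assoc,
      ENNReal.mul_inv_cancel h1 h2, mul_one]
  have h : p.userIntensity.prod p.displacementLaw =
      (ENNReal.ofReal p.lam * volume p.cell) • p.pairLaw := by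
    rw [h0, pairLaw, displacementLaw, Measure.prod_smul_left]
  have hψ : Measurable fun v : Plane => ENNReal.ofReal (p.pD2D ‖v‖) * φ ‖v‖ :=
    (p.measurable_pD2D.comp measurable_norm).ennreal_ofReal.mul (hφ.comp measurable_norm)
  rw [h, lintegral_smul_measure, p.lintegral_underlay_pairLaw hφ, ← lintegral_smul_measure, ← h,
    ← lintegral_map hψ hadd, p.map_add_eq_withDensity,
    lintegral_withDensity_eq_lintegral_mul _ p.measurable_receiverDensity hψ]
  exact lintegral_congr fun v => mul_comm _ _

end Params

namespace Network.IsModel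

variable {Ω : Type*} {S : Network Ω} [MeasurableSpace Ω] {P : Measure Ω} [IsProbabilityMeasure P]
  {p : Params} (hS : S.IsModel p P)
include hS

lemma outage_le_one (d : ℝ) : S.outage p P d ≤ 1 := by
  rw [outage, hS.outageAt_eq]
  refine ENNReal.toReal_le_of_le_ofReal zero_le_one ?_
  rw [ENNReal.ofReal_one, ← hS.typicalProb_Iio_add_Ioi !₂[d, 0]]
  exact le_self_add

lemma intensity_outageReceiverPoints :
    intensity P (S.outageReceiverPoints p) = (intensity P (S.underlayReceiverPoints p)).withDensity
      (fun v => ENNReal.ofReal (S.outage p P ‖v‖)) := by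
  have hU := p.measurableSet_underlay_displacement
  rw [S.outageReceiverPoints_eq, S.underlayReceiverPoints_eq,
    hS.intensity_selectedReceivers_univ hU, hS.intensity_selectedReceivers hU measurableSet_Iio]
  congr 1
  funext v
  rw [← hS.outageAt_eq_outage, hS.ofReal_outageAt]

lemma lintegral_successCount :
    ∫⁻ ω, (S.successCount p ω : ℝ≥0∞) ∂P =
      ∫⁻ v : Plane, ENNReal.ofReal
        ((1 - S.outage p P ‖v‖) * p.pD2D ‖v‖ * S.lamDRx P ‖v‖) := by
  have hU := p.measurableSet_underlay_displacement
  have hφ : Measurable fun d => ENNReal.ofReal (1 - S.outage p P d) :=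
    (measurable_const.sub hS.measurable_outage).ennreal_ofReal
  simp only [S.successCount_eq]
  rw [hS.lintegral_sum_range_eq (measurable_one.indicator hU) measurableSet_Ioi]
  have h1 : ∀ q : Plane × Plane, p.typicalProb (Set.Ioi p.γ) (q.1 + q.2) =
      ENNReal.ofReal (1 - S.outage p P ‖q.1 + q.2‖) := fun q => by
    rw [← hS.outageAt_eq_outage, hS.ofReal_one_sub_outageAt]
  simp only [h1]
  rw [p.lintegral_underlay hφ]
  refine lintegral_congr_ae ?_
  filter_upwards [hS.ofReal_lamDRx_norm] with v hv
  rw [← hv, mul_comm (ENNReal.ofReal (p.pD2D ‖v‖)), ← ENNReal.ofReal_mul, ← ENNReal.ofReal_mul]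
  · exact mul_nonneg (sub_nonneg.2 (hS.outage_le_one _)) (p.pD2D_nonneg _)
  · exact sub_nonneg.2 (hS.outage_le_one _)

lemma lintegral_successCount_ne_top : ∫⁻ ω, (S.successCount p ω : ℝ≥0∞) ∂P ≠ ∞ := by
  have hU := p.measurableSet_underlay_displacement
  simp only [S.successCount_eq]
  rw [hS.lintegral_sum_range_eq (measurable_one.indicator hU) measurableSet_Ioi]
  refine ne_top_of_le_ne_top
    (measure_ne_top (p.userIntensity.prod p.displacementLaw) Set.univ) ?_
  rw [← lintegral_one]
  refine lintegral_mono fun q => mul_le_one' (Set.indicator_le_self' (by simp) _) ?_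
  rw [← hS.typicalProb_Iio_add_Ioi (q.1 + q.2)]
  exact le_add_self

omit [IsProbabilityMeasure P] in
lemma measurable_successCount : Measurable fun ω => (S.successCount p ω : ℝ) := by
  have h : Measurable fun ω => (S.successCount p ω : ℝ≥0∞) := by
    simp only [S.successCount_eq]
    exact hS.measurable_sum_weights (measurable_one.indicator
      p.measurableSet_underlay_displacement) measurableSet_Ioi
  simpa using h.ennreal_toReal

omit hS [IsProbabilityMeasure P] in
lemma measurable_lamDRx : Measurable (S.lamDRx P) :=
  (Measure.measurable_rnDeriv _ _).ennreal_toReal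

lemma lamDRx_norm_eq_zero :
    ∀ᵐ v : Plane, p.R + p.RD < ‖v‖ → S.lamDRx P ‖v‖ = 0 := by
  filter_upwards [hS.ofReal_lamDRx_norm] with v hv h
  rw [p.receiverDensity_eq_zero h, ENNReal.ofReal_eq_zero] at hv
  exact le_antisymm hv ENNReal.toReal_nonneg

end Network.IsModel

end D2D

end

theorem proposition3 {Ω : Type*} [MeasurableSpace Ω] (P : Measure Ω) [IsProbabilityMeasure P]
    (p : D2D.Params) (S : D2D.Network Ω) (hS : S.IsModel p P) :
    -- `λ^DRx` is the node density of the D2D receivers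
    D2D.intensity P S.receiverPoints =
      volume.withDensity (fun v => ENNReal.ofReal (S.lamDRx P ‖v‖)) ∧
    -- the outage probability at a receiver depends only on its distance from the base station
    (∀ v : Plane, S.outageAt p P v = S.outage p P ‖v‖) ∧
    -- it is the conditional probability of outage given an underlay D2D receiver at that location
    D2D.intensity P (S.outageReceiverPoints p) =
      (D2D.intensity P (S.underlayReceiverPoints p)).withDensity
        (fun v => ENNReal.ofReal (S.outage p P ‖v‖)) ∧
    -- the average number of successful D2D transmissions
    Integrable (fun ω => (S.successCount p ω : ℝ)) P ∧
    IntervalIntegrable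
      (fun d => (1 - S.outage p P d) * p.pD2D d * S.lamDRx P d * (2 * Real.pi * d))
      volume 0 (p.R + p.RD) ∧
    ∫ ω, (S.successCount p ω : ℝ) ∂P =
      ∫ d in (0 : ℝ)..(p.R + p.RD),
        (1 - S.outage p P d) * p.pD2D d * S.lamDRx P d * (2 * Real.pi * d) := by
  have hR : 0 ≤ p.R + p.RD := (add_pos p.R_pos p.RD_pos).le
  set f : ℝ → ℝ := fun d => (1 - S.outage p P d) * p.pD2D d * S.lamDRx P d with hf
  have hf0 : ∀ d, 0 ≤ f d := fun d => mul_nonneg (mul_nonneg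
    (sub_nonneg.2 (hS.outage_le_one d)) (p.pD2D_nonneg d)) ENNReal.toReal_nonneg
  have hfm : Measurable f := ((measurable_const.sub hS.measurable_outage).mul
    p.measurable_pD2D).mul D2D.Network.IsModel.measurable_lamDRx
  have hmean : ∫⁻ ω, (S.successCount p ω : ℝ≥0∞) ∂P = ∫⁻ v : Plane, ENNReal.ofReal (f ‖v‖) :=
    hS.lintegral_successCount
  have hfin : ∫⁻ v : Plane, ENNReal.ofReal (f ‖v‖) ≠ ∞ :=
    hmean ▸ hS.lintegral_successCount_ne_top
  have hcount : ∀ ω, ENNReal.ofReal (S.successCount p ω : ℝ) = S.successCount p ω := fun ω =>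
    ENNReal.ofReal_natCast _
  have hfi : Integrable fun v : Plane => f ‖v‖ :=
    (lintegral_ofReal_ne_top_iff_integrable (hfm.comp measurable_norm).aestronglyMeasurable
      (Filter.Eventually.of_forall fun v => hf0 _)).1 hfin
  -- there are no receivers beyond distance `R + RD`, so `f` may be cut off there before the passage
  -- to polar coordinates
  have hind : (fun v : Plane => f ‖v‖) =ᵐ[volume]
      fun v => (Set.Iic (p.R + p.RD)).indicator f ‖v‖ := by
    filter_upwards [hS.lamDRx_norm_eq_zero] with v hv
    by_cases h : ‖v‖ ≤ p.R + p.RD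
    · rw [Set.indicator_of_mem (by exact h)]
    · rw [Set.indicator_of_notMem (by exact h)]
      simp [hf, hv (not_le.1 h)]
  have hcut : ∀ y : ℝ, y ^ (Module.finrank ℝ Plane - 1) • (Set.Iic (p.R + p.RD)).indicator f y =
      (Set.Iic (p.R + p.RD)).indicator (fun d => d * f d) y := by
    intro y
    by_cases h : y ≤ p.R + p.RD <;> simp [h]
  have hIoc : Set.Ioi 0 ∩ Set.Iic (p.R + p.RD) = Set.Ioc 0 (p.R + p.RD) := Set.Ioi_inter_Iic
  have hvol : (volume : Measure Plane).real (Metric.ball 0 1) = Real.pi := by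
    rw [measureReal_def, EuclideanSpace.volume_ball_fin_two]
    simp [Real.pi_pos.le]
  have hform : ∀ d, (1 - S.outage p P d) * p.pD2D d * S.lamDRx P d * (2 * Real.pi * d) =
      (2 * Real.pi) * (d * f d) := fun d => by simp only [hf]; ring
  have hint : IntegrableOn (fun d => d * f d) (Set.Ioc 0 (p.R + p.RD)) := by
    have h := (integrable_fun_norm_addHaar (volume : Measure Plane)).1 (hfi.congr hind)
    simp only [hcut] at h
    rwa [IntegrableOn, integrable_indicator_iff measurableSet_Iic, IntegrableOn,
      Measure.restrict_restrict measurableSet_Iic, Set.inter_comm, hIoc] at h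
  refine ⟨?_, hS.outageAt_eq_outage, hS.intensity_outageReceiverPoints, ?_, ?_, ?_⟩
  · rw [hS.intensity_receiverPoints]
    exact (withDensity_congr_ae hS.ofReal_lamDRx_norm).symm
  · refine (lintegral_ofReal_ne_top_iff_integrable hS.measurable_successCount.aestronglyMeasurable
      (Filter.Eventually.of_forall fun ω => Nat.cast_nonneg _)).1 ?_
    simp only [hcount]
    exact hS.lintegral_successCount_ne_top
  · simp only [hform]
    rw [intervalIntegrable_iff_integrableOn_Ioc_of_le hR]
    exact hint.const_mul _
  · simp only [hform]
    rw [intervalIntegral.integral_const_mul, intervalIntegral.integral_of_le hR,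
      integral_eq_lintegral_of_nonneg_ae (Filter.Eventually.of_forall fun ω => Nat.cast_nonneg _)
        hS.measurable_successCount.aestronglyMeasurable]
    simp only [hcount]
    rw [hmean, ← integral_eq_lintegral_of_nonneg_ae (Filter.Eventually.of_forall fun v => hf0 _)
      (hfm.comp measurable_norm).aestronglyMeasurable, integral_congr_ae hind,
      integral_fun_norm_addHaar, hvol]
    simp only [hcut]
    rw [integral_indicator measurableSet_Iic, Measure.restrict_restrict measurableSet_Iic,
      Set.inter_comm, hIoc]
    simp
    ring
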